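/- **Theorem 1.2 (asymptotic estimates on $\Sigma_-$).** Let $\Omega\subset\mathbb{R}^d$ be a bounded domain with $\partial\Omega\in C^{1,1}$ and unit outward normal $n_x$, and let $\Lambda>0$. For $z_0=(t_0,x_0,v_0)\in\mathbb{R}^{1+2d}$ and $r>0$ put $$Q_r(z_0)=\{(t,x,v):\ t_0-r^2<t\le t_0,\ |x-x_0-(t-t_0)v_0|<r^3,\ |v-v_0|<r\},\qquad G_r(z_0)=\{(t,x,v)\in Q_r(z_0):\ x\in\overline\Omega\},$$ and let $\Sigma_-=\{(t,x,v):\ x\in\partial\Omega,\ n_x\cdot v<0\}$. There is a constant $C_\star>0$ depending only on $d,\Lambda,\Omega$ and $|z_0|$ such that the following holds for every $z_0\in\Sigma_-$, every $\lambda\in(0,\Lambda)$ (so that $C_\star$ does not depend on $\lambda$), and all $A,B,S,f$ as follows. The coefficients $A(z)$ (real symmetric $d\times d$ matrices), $B(z)\in\mathbb{R}^d$ and the source $S(z)\in\mathbb{R}$ satisfy $\lambda I_d\le A(z)\le\Lambda I_d$ and $|B(z)|\le\Lambda(1+|v|^2)$ in the interior of $G_2(z_0)$, and $S\in L^\infty(G_2(z_0))$.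 The function $f$ is a classical solution in $G_2(z_0)$ of $$\partial_tf+v\cdot\nabla_xf=A:D_v^2f+B\cdot\nabla_vf+S$$ with $f=0$ on $\Sigma_-\cap G_2(z_0)$; that is, $(\partial_t+v\cdot\nabla_x)f$ and $D_v^2f$ are continuous in the interior $\{t<t_0,\ x\in\Omega\}$ of $G_2(z_0)$, the equation holds there pointwise, and $f$ is continuous on $G_2(z_0)\cap\{x\in\Omega\}$ and up to $\Sigma_-\cap G_2(z_0)$, where it vanishes. Write $\|f\|_\infty=\sup_{G_2(z_0)}|f|$ and $\|S\|_\infty=\|S\|_{L^\infty(G_2(z_0))}$. (i) (Gradient estimate) For every $z\in G_1(z_0)$, $$|f(z)|\le\frac{C_\star\,|z-z_0|}{|v_0\cdot n_{x_0}|^3}\,\big(\|f\|_\infty+\|S\|_\infty\big).$$ (ii) (Infinite-order vanishing) If additionally $S=0$ in the interior of $G_2(z_0)$, then for every $x\in\mathbb{R}^d$ with $(t_0,x,v_0)\in G_1(z_0)$, $|x-x_0|\le|v_0\cdot n_{x_0}|/C_\star$ and $0<\mathrm{dist}(x,\partial\Omega)\le|v_0\cdot n_{x_0}|^3$, $$|f(t_0,x,v_0)|\le\|f\|_\infty\,\exp\Big(1-\frac{|n_{x_0}\cdot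 v_0|^3}{C_\star\,\mathrm{dist}(x,\partial\Omega)}\Big).$$ -/

import Mathlib

open scoped ENNReal
open MeasureTheory

namespace KFP

/-- Velocity space and position space: `ℝ^d` with its Euclidean norm. -/
abbrev Vec (d : ℕ) : Type := EuclideanSpace ℝ (Fin d)

/-- Points `z = (t, x, v)` of `ℝ × ℝ^d × ℝ^d = ℝ^{1+2d}`. -/
abbrev Pt (d : ℕ) : Type := ℝ × Vec d × Vec d

/-- The Euclidean norm `|z|` on `ℝ^{1+2d}` (the norm that Lean puts on a product is the
maximum norm, so the Euclidean one is spelled out). -/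
noncomputable def absPt {d : ℕ} (z : Pt d) : ℝ :=
  Real.sqrt (z.1 ^ 2 + ‖z.2.1‖ ^ 2 + ‖z.2.2‖ ^ 2)

/-- `Ω` has a `C^{1,1}` boundary: near each boundary point, `Ω` is the strict subgraph, in some
unit direction `e`, of a `C^1` function with Lipschitz derivative on the hyperplane `e^⊥`. -/
def HasC11Boundary {d : ℕ} (Ω : Set (Vec d)) : Prop :=
  ∀ y ∈ frontier Ω, ∃ e : Vec d, ‖e‖ = 1 ∧
    ∃ γ : (Submodule.span ℝ {e})ᗮ → ℝ,
      ContDiff ℝ 1 γ ∧ (∃ K, LipschitzWith K (fderiv ℝ γ)) ∧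
      ∃ r > 0, ∀ x ∈ Metric.ball y r,
        (x ∈ Ω ↔ inner ℝ e x < γ ((Submodule.span ℝ {e})ᗮ.orthogonalProjectionOnto x))

/-- `n` is the unit outward normal to `Ω` at the boundary point `y`: a unit vector with
`limsup ⟨x - y, n⟩ / |x - y| ≤ 0` as `x → y` in `Ω`.  For a domain with `C^1` boundary the tangent
cone at `y` is a half-space, so exactly one `n` has this property. -/
def IsOuterUnitNormal {d : ℕ} (Ω : Set (Vec d)) (y n : Vec d) : Prop :=
  ‖n‖ = 1 ∧ ∀ ε > 0, ∀ᶠ x in nhdsWithin y Ω, inner ℝ (x - y) n ≤ ε * ‖x - y‖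

/-- The incoming boundary `Σ₋`: `x ∈ ∂Ω` and `n_x · v < 0`. -/
def incoming {d : ℕ} (Ω : Set (Vec d)) : Set (Pt d) :=
  {z | z.2.1 ∈ frontier Ω ∧ ∃ n, IsOuterUnitNormal Ω z.2.1 n ∧ inner ℝ n z.2.2 < 0}

/-- The kinetic cylinder `Q_r(z₀)`. -/
def cyl {d : ℕ} (r : ℝ) (z₀ : Pt d) : Set (Pt d) :=
  {z | z₀.1 - r ^ 2 < z.1 ∧ z.1 ≤ z₀.1 ∧
    ‖z.2.1 - z₀.2.1 - (z.1 - z₀.1) • z₀.2.2‖ < r ^ 3 ∧ ‖z.2.2 - z₀.2.2‖ < r}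

/-- The local domain `G_r(z₀)`: points of `Q_r(z₀)` with `x` in the closure of `Ω`. -/
def locDom {d : ℕ} (Ω : Set (Vec d)) (r : ℝ) (z₀ : Pt d) : Set (Pt d) :=
  {z | z ∈ cyl r z₀ ∧ z.2.1 ∈ closure Ω}

/-- The points of `G_r(z₀)` with `x ∈ Ω`, the final time included. -/
def locDomInner {d : ℕ} (Ω : Set (Vec d)) (r : ℝ) (z₀ : Pt d) : Set (Pt d) :=
  {z | z ∈ cyl r z₀ ∧ z.2.1 ∈ Ω}

/-- The interior of `G_r(z₀)`: `x ∈ Ω`, and the final time is excluded. -/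
def locDomInt {d : ℕ} (Ω : Set (Vec d)) (r : ℝ) (z₀ : Pt d) : Set (Pt d) :=
  {z | z ∈ cyl r z₀ ∧ z.1 < z₀.1 ∧ z.2.1 ∈ Ω}

/-- The transport derivative `(∂_t + v · ∇_x) f`, the derivative along `s ↦ (t + s, x + s v, v)`. -/
noncomputable def transport {d : ℕ} (f : Pt d → ℝ) (z : Pt d) : ℝ :=
  deriv (fun s : ℝ => f (z.1 + s, z.2.1 + s • z.2.2, z.2.2)) 0

/-- The velocity gradient `∇_v f`. -/
noncomputable def gradV {d : ℕ} (f : Pt d → ℝ) (z : Pt d) : Vec d :=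
  gradient (fun w : Vec d => f (z.1, z.2.1, w)) z.2.2

/-- The velocity Hessian `D_v² f`. -/
noncomputable def hessV {d : ℕ} (f : Pt d → ℝ) (z : Pt d) : Matrix (Fin d) (Fin d) ℝ :=
  Matrix.of fun i j =>
    iteratedFDeriv ℝ 2 (fun w : Vec d => f (z.1, z.2.1, w)) z.2.2
      ![EuclideanSpace.single i 1, EuclideanSpace.single j 1]

/-- The structural conditions on the set `U`: `A` is symmetric with `lam I ≤ A ≤ Lam I`,
`|B| ≤ Lam (1 + |v|²)`. -/
def Elliptic {d : ℕ} (lam Lam : ℝ) (A : Pt d → Matrix (Fin d) (Fin d) ℝ) (B : Pt d → Vec d)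
    (U : Set (Pt d)) : Prop :=
  ∀ z ∈ U, (A z).IsSymm ∧
    (A z - lam • (1 : Matrix (Fin d) (Fin d) ℝ)).PosSemidef ∧
    (Lam • (1 : Matrix (Fin d) (Fin d) ℝ) - A z).PosSemidef ∧
    ‖B z‖ ≤ Lam * (1 + ‖z.2.2‖ ^ 2)

/-- `f` is a classical solution in `G_r(z₀)` of
`∂_t f + v · ∇_x f = A : D_v² f + B · ∇_v f + S` with `f = 0` on `Σ₋`:
`(∂_t + v · ∇_x) f` and `D_v² f` exist and are continuous in the interior, the equation holds
at every interior point, and `f` is continuous up to the final time and up to `Σ₋`, where it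
vanishes.  Nothing is required on the outgoing and grazing boundaries. -/
structure IsSolution {d : ℕ} (Ω : Set (Vec d)) (A : Pt d → Matrix (Fin d) (Fin d) ℝ)
    (B : Pt d → Vec d) (S : Pt d → ℝ) (r : ℝ) (z₀ : Pt d) (f : Pt d → ℝ) : Prop where
  continuousOn : ContinuousOn f (locDomInner Ω r z₀ ∪ (incoming Ω ∩ cyl r z₀))
  contDiffAt_v : ∀ z ∈ locDomInt Ω r z₀,
    ContDiffAt ℝ 2 (fun w : Vec d => f (z.1, z.2.1, w)) z.2.2
  continuousOn_hessV : ContinuousOn (hessV f) (locDomInt Ω r z₀)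
  differentiableAt_transport : ∀ z ∈ locDomInt Ω r z₀,
    DifferentiableAt ℝ (fun s : ℝ => f (z.1 + s, z.2.1 + s • z.2.2, z.2.2)) 0
  continuousOn_transport : ContinuousOn (transport f) (locDomInt Ω r z₀)
  equation : ∀ z ∈ locDomInt Ω r z₀,
    transport f z = (∑ i, ∑ j, A z i j * hessV f z i j) + inner ℝ (B z) (gradV f z) + S z
  boundary : ∀ z ∈ incoming Ω ∩ cyl r z₀, f z = 0

/-- The supremum norm of `f` on `G`, possibly `∞`. -/
noncomputable def supNorm {d : ℕ} (f : Pt d → ℝ) (G : Set (Pt d)) : ℝ≥0∞ :=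
  ⨆ z ∈ G, ‖f z‖ₑ

/-- The `L^∞(G)` norm (essential supremum) of `S`, possibly `∞`. -/
noncomputable def essNorm {d : ℕ} (S : Pt d → ℝ) (G : Set (Pt d)) : ℝ≥0∞ :=
  eLpNorm S ⊤ (volume.restrict G)

end KFP

namespace KFP

/-! The proof is a comparison with an explicit barrier. Put `ν = -n₀ · v₀ > 0` and let `ψ` be a
`C^{1,1}` defining function, positive in `Ω`. Since `∇ψ` is a negative multiple of the outward
normal on the boundary, `v · ∇ψ ≥ ν / 2` when `x`, `v` are within `b = c ν` of `x₀`, `v₀`. Transport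
thus pushes `ψ` up at a definite rate, and a large multiple of `ψ` absorbs every other term of the
equation. No ellipticity from below is needed: only `0 ≤ A ≤ Λ` enters, so the constants are
independent of `λ`.

The barrier is `F(w)` with `w = b⁻² (|v - v₀|² + |x - x₀|² + t₀ - t) + κ ψ(x)` and `F` increasing
and convex. In the box of size `b`, every boundary point of `Ω` is incoming, so `f = 0 ≤ F(w)`
there; on the remaining sides and at the initial time `w ≥ 1`, so `|f| ≤ F(1) ≤ F(w)`. If `F'' ≤ μ
F'`, then `κ` of order `(1 + μ) / (b² ν)` makes `F(w)` a strict supersolution (`abs_le_barrier`),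
and the maximum principle (`no_interior_max`, `le_barrier`) gives `|f| ≤ F(w)`.

For (i), `F` is linear and `μ = 0`; then `κ` is of order `ν⁻³`, and `w` is at most a constant times
`|z - z₀| / ν³`. For (ii), `F(s) = ‖f‖ exp(μ (s - 1))`; as `ψ` is at most a constant times `δ =
dist(x, ∂Ω)`, one can afford `μ` of order `ν³ / δ` while keeping `w ≤ 1/2`, which gives the factor
`exp(-μ / 2)`.

The maximum principle needs care: `A`, `B`, `S` may be discontinuous and `S` is bounded only almost
everywhere, so `exists_coeff_transport_le` borrows the coefficients from a nearby good point. -/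

/-! ### Second derivative test and matrix inequalities. -/

theorem hasDerivAt_line {E : Type*} [NormedAddCommGroup E] [NormedSpace ℝ E] {g : E → ℝ}
    {v u : E} {s : ℝ} (hg : ContDiffAt ℝ 2 g (v + s • u)) :
    HasDerivAt (fun s : ℝ => g (v + s • u)) (fderiv ℝ g (v + s • u) u) s ∧
      HasDerivAt (fun s : ℝ => fderiv ℝ g (v + s • u) u)
        (iteratedFDeriv ℝ 2 g (v + s • u) ![u, u]) s := by
  have hl : HasDerivAt (fun s : ℝ => v + s • u) u s := by
    simpa using ((hasDerivAt_id s).smul_const u).const_add v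
  constructor
  · exact (hg.differentiableAt (by norm_num)).hasFDerivAt.comp_hasDerivAt s hl
  · have h1 : DifferentiableAt ℝ (fderiv ℝ g) (v + s • u) :=
      (hg.fderiv_right (m := 1) (by norm_num)).differentiableAt (by norm_num)
    have h2 := h1.hasFDerivAt.comp_hasDerivAt s hl
    have h3 := h2.clm_apply (hasDerivAt_const s u)
    simpa [iteratedFDeriv_two_apply] using h3

/-- If `c > 0`, the point is also a local minimum, so `g` is locally constant and `c = 0`. -/
theorem second_deriv_nonpos_of_isLocalMax {g g₁ : ℝ → ℝ} {c a : ℝ} (hmax : IsLocalMax g a)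
    (h1 : ∀ᶠ s in nhds a, HasDerivAt g (g₁ s) s) (h2 : HasDerivAt g₁ c a) : c ≤ 0 := by
  by_contra! hc
  have e1 : deriv g =ᶠ[nhds a] g₁ := h1.mono fun s hs => hs.deriv
  have hd : deriv (deriv g) a = c := by rw [e1.deriv_eq]; exact h2.deriv
  have hmin : IsLocalMin g a :=
    isLocalMin_of_deriv_deriv_pos (by rw [hd]; exact hc) hmax.deriv_eq_zero
      h1.self_of_nhds.continuousAt
  have hconst : g =ᶠ[nhds a] fun _ => g a := by
    filter_upwards [hmax, hmin] with s hs hs' using le_antisymm hs hs'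
  have e2 : deriv g =ᶠ[nhds a] fun _ => 0 := by
    simpa using hconst.deriv
  rw [e2.deriv_eq] at hd
  simp at hd
  linarith

/-- The trace of a product of two positive semidefinite forms is nonnegative. -/
theorem sum_mul_nonneg_of_posSemidef {d : ℕ} {A P : Matrix (Fin d) (Fin d) ℝ}
    (hA : A.PosSemidef) (hP : ∀ u : Fin d → ℝ, 0 ≤ ∑ i, ∑ j, u i * u j * P i j) :
    0 ≤ ∑ i, ∑ j, A i j * P i j := by
  open scoped MatrixOrder in
  -- Factoring `A = Cᵀ C` turns the trace into the sum of the values of the form `P` on the rows of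
  -- `C`.
  obtain ⟨C, rfl⟩ := CStarAlgebra.nonneg_iff_eq_star_mul_self.1 hA.nonneg
  have : ∑ i, ∑ j, (star C * C) i j * P i j = ∑ k, ∑ i, ∑ j, C k i * C k j * P i j := by
    simp only [Matrix.mul_apply, Matrix.star_apply, star_trivial, Finset.sum_mul]
    conv_rhs => rw [Finset.sum_comm]
    exact Finset.sum_congr rfl fun i _ => Finset.sum_comm
  rw [this]
  exact Finset.sum_nonneg fun k _ => hP (C k)

theorem quadForm_le_of_posSemidef {d : ℕ} {Lam : ℝ} {A : Matrix (Fin d) (Fin d) ℝ}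
    (hA : (Lam • (1 : Matrix (Fin d) (Fin d) ℝ) - A).PosSemidef) (u : Fin d → ℝ) :
    ∑ i, ∑ j, A i j * (u i * u j) ≤ Lam * ∑ i, u i ^ 2 := by
  have := sum_mul_nonneg_of_posSemidef (P := Matrix.of fun i j => u i * u j) hA (fun w => by
    have : ∑ i, ∑ j, w i * w j * (Matrix.of fun i j => u i * u j) i j = (∑ i, w i * u i) ^ 2 := by
      rw [sq, Finset.sum_mul_sum]
      refine Finset.sum_congr rfl fun i _ => Finset.sum_congr rfl fun j _ => ?_
      simp; ring
    rw [this]; positivity)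
  simp only [Matrix.sub_apply, Matrix.smul_apply, Matrix.of_apply, sub_mul, Matrix.one_apply,
    Finset.sum_sub_distrib, smul_eq_mul, mul_ite, mul_one, mul_zero, ite_mul, zero_mul,
    Finset.sum_ite_eq, Finset.mem_univ, if_true] at this
  rw [Finset.mul_sum]
  simp only [sq]
  linarith

theorem trace_le_of_posSemidef {d : ℕ} {Lam : ℝ} {A : Matrix (Fin d) (Fin d) ℝ}
    (hA : (Lam • (1 : Matrix (Fin d) (Fin d) ℝ) - A).PosSemidef) :
    ∑ i, A i i ≤ d * Lam := by
  have := hA.trace_nonneg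
  simp [Matrix.trace_sub, Matrix.trace_smul] at this
  simp [Matrix.trace] at this
  linarith

/-- Testing the form on `eᵢ ± eⱼ` bounds `|A i j|` by the mean of two diagonal entries. This makes
the errors in `exists_coeff_transport_le` uniform in the point where the coefficients are taken. -/
theorem abs_entry_le_of_posSemidef {d : ℕ} {Lam : ℝ} {A : Matrix (Fin d) (Fin d) ℝ}
    (hA : A.PosSemidef) (hA' : (Lam • (1 : Matrix (Fin d) (Fin d) ℝ) - A).PosSemidef)
    (i j : Fin d) : |A i j| ≤ Lam := by
  have hdiag : ∀ k, A k k ≤ Lam := fun k => by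
    have := hA'.diag_nonneg (i := k)
    simpa [Matrix.sub_apply] using this
  have hq : ∀ s : ℝ, 0 ≤ A i i + s * A i j + s * A j i + s ^ 2 * A j j := fun s => by
    have := sum_mul_nonneg_of_posSemidef (P := Matrix.of fun k l =>
      ((Pi.single i 1 : Fin d → ℝ) k + s * (Pi.single j 1 : Fin d → ℝ) k) *
      ((Pi.single i 1 : Fin d → ℝ) l + s * (Pi.single j 1 : Fin d → ℝ) l)) hA (fun w => by
        have : ∑ k, ∑ l, w k * w l * (((Pi.single i 1 : Fin d → ℝ) k +
            s * (Pi.single j 1 : Fin d → ℝ) k) * ((Pi.single i 1 : Fin d → ℝ) l +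
            s * (Pi.single j 1 : Fin d → ℝ) l)) = (∑ k, w k * ((Pi.single i 1 : Fin d → ℝ) k +
            s * (Pi.single j 1 : Fin d → ℝ) k)) ^ 2 := by
          rw [sq, Finset.sum_mul_sum]
          refine Finset.sum_congr rfl fun i _ => Finset.sum_congr rfl fun j _ => ?_
          ring
        simp only [Matrix.of_apply]
        rw [this]; positivity)
    simp [Pi.single_apply, mul_add, add_mul, Finset.sum_add_distrib] at this
    nlinarith
  have hs : A j i = A i j := by simpa using hA.1.apply i j
  have h1 := hq 1
  have h2 := hq (-1)
  rw [hs] at h1 h2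
  have := hdiag i
  have := hdiag j
  rw [abs_le]
  constructor <;> linarith

theorem iteratedFDeriv_two_eq_sum_hessV {d : ℕ} (f : Pt d → ℝ) (z : Pt d) (u : Vec d) :
    iteratedFDeriv ℝ 2 (fun w : Vec d => f (z.1, z.2.1, w)) z.2.2 ![u, u]
      = ∑ i, ∑ j, u i * u j * hessV f z i j := by
  simp only [hessV, Matrix.of_apply, iteratedFDeriv_two_apply]
  set L := fderiv ℝ (fderiv ℝ fun w : Vec d => f (z.1, z.2.1, w)) z.2.2
  have hu : u = ∑ i, u i • EuclideanSpace.single i (1 : ℝ) := by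
    ext k; simp [Finset.sum_apply, Pi.single_apply]
  conv_lhs => rw [hu]
  simp [map_sum, Finset.mul_sum, mul_assoc]
  rw [Finset.sum_comm]
  exact Finset.sum_congr rfl fun i _ => Finset.sum_congr rfl fun j _ => by ring

/-! ### Continuity of the velocity gradient. -/

theorem abs_sub_sub_mul_deriv_le {g g₁ g₂ : ℝ → ℝ} {h C : ℝ} (hh : 0 ≤ h)
    (h1 : ∀ s ∈ Set.Icc 0 h, HasDerivAt g (g₁ s) s)
    (h2 : ∀ s ∈ Set.Icc 0 h, HasDerivAt g₁ (g₂ s) s)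
    (hC : ∀ s ∈ Set.Icc 0 h, |g₂ s| ≤ C) : |g h - g 0 - h * g₁ 0| ≤ C * h * h := by
  have h0 : (0 : ℝ) ∈ Set.Icc 0 h := ⟨le_rfl, hh⟩
  have hC0 : 0 ≤ C := (abs_nonneg _).trans (hC 0 h0)
  have key : ∀ s ∈ Set.Icc 0 h, |g₁ s - g₁ 0| ≤ C * h := fun s hs => by
    have := (convex_Icc 0 h).norm_image_sub_le_of_norm_hasDerivWithin_le
      (fun x hx => (h2 x hx).hasDerivWithinAt) hC h0 hs
    refine this.trans ?_
    rw [sub_zero, Real.norm_of_nonneg hs.1]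
    exact mul_le_mul_of_nonneg_left hs.2 hC0
  have := (convex_Icc 0 h).norm_image_sub_le_of_norm_hasDerivWithin_le
      (f := fun s => g s - s * g₁ 0) (f' := fun s => g₁ s - 1 * g₁ 0)
      (fun x hx => ((h1 x hx).sub ((hasDerivAt_id x).mul_const _)).hasDerivWithinAt)
      (fun s hs => by simpa using key s hs) h0 ⟨hh, le_rfl⟩
  simp only [zero_mul, sub_zero, Real.norm_eq_abs, abs_of_nonneg hh] at this
  rw [show g h - g 0 - h * g₁ 0 = g h - h * g₁ 0 - g 0 by ring]
  exact this

/-- A neighbourhood of `z` contains short segments in the velocity direction `e` starting from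
all points near `z`. -/
theorem exists_velocity_segment_mem {d : ℕ} {U : Set (Pt d)} {z : Pt d} (hU : U ∈ nhds z) (e : Vec d) :
    ∃ δ > 0, ∀ᶠ y in nhds z, ∀ s ∈ Set.Icc (0 : ℝ) δ, (y.1, y.2.1, y.2.2 + s • e) ∈ U := by
  have hc : ContinuousAt (fun p : ℝ × Pt d => ((p.2.1, p.2.2.1, p.2.2.2 + p.1 • e) : Pt d))
      (0, z) := by fun_prop
  have : (fun p : ℝ × Pt d => ((p.2.1, p.2.2.1, p.2.2.2 + p.1 • e) : Pt d)) ⁻¹' U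
      ∈ nhds ((0 : ℝ), z) := hc (by simpa using hU)
  rw [nhds_prod_eq, Filter.mem_prod_iff] at this
  obtain ⟨V, hV, W, hW, hVW⟩ := this
  obtain ⟨ε, hε, hb⟩ := Metric.mem_nhds_iff.1 hV
  refine ⟨ε / 2, half_pos hε, ?_⟩
  filter_upwards [hW] with y hy s hs
  have hs' : s ∈ V := hb (by
    rw [Metric.mem_ball, dist_zero_right, Real.norm_of_nonneg hs.1]; linarith [hs.2])
  exact hVW (Set.mk_mem_prod hs' hy)

theorem inner_gradV {d : ℕ} {f : Pt d → ℝ} {z : Pt d} (u : Vec d) :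
    inner ℝ (gradV f z) u = fderiv ℝ (fun w : Vec d => f (z.1, z.2.1, w)) z.2.2 u := by
  simp [gradV, gradient]

/-- Joint continuity of the velocity gradient is not part of the notion of solution. It follows from
Taylor's formula: the Hessian is locally bounded, so the gradient is a locally uniform limit of
difference quotients of the continuous `f`. -/
theorem continuousAt_inner_gradV {d : ℕ} {f : Pt d → ℝ} {U : Set (Pt d)} (hU : IsOpen U)
    (hf : ContinuousOn f U)
    (h2 : ∀ z ∈ U, ContDiffAt ℝ 2 (fun w : Vec d => f (z.1, z.2.1, w)) z.2.2)
    (hH : ContinuousOn (hessV f) U) {z : Pt d} (hz : z ∈ U) (e : Vec d) :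
    ContinuousAt (fun y => (inner ℝ (gradV f y) e : ℝ)) z := by
  set q : Pt d → ℝ := fun y => ∑ i, ∑ j, e i * e j * hessV f y i j with hq
  have hqc : ContinuousAt q z := by
    have hHz : ContinuousAt (hessV f) z := hH.continuousAt (hU.mem_nhds hz)
    have hent : ∀ i j, ContinuousAt (fun y => hessV f y i j) z := fun i j =>
      continuousAt_pi.1 (continuousAt_pi.1 hHz i) j
    refine tendsto_finsetSum _ fun i _ => tendsto_finsetSum _ fun j _ => ?_
    exact (hent i j).const_mul _
  set C := |q z| + 1
  have hN : {y | y ∈ U ∧ |q y| < C} ∈ nhds z :=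
    Filter.inter_mem (hU.mem_nhds hz) (hqc.abs.eventually_lt_const (by simp [C]))
  obtain ⟨δ, hδ, hev⟩ := exists_velocity_segment_mem hN e
  have hC : 0 < C := by positivity
  have taylor : ∀ y : Pt d, ∀ h, 0 ≤ h → h ≤ δ →
      (∀ s ∈ Set.Icc (0 : ℝ) δ, (y.1, y.2.1, y.2.2 + s • e) ∈ {y | y ∈ U ∧ |q y| < C}) →
      |f (y.1, y.2.1, y.2.2 + h • e) - f y - h * inner ℝ (gradV f y) e| ≤ C * h * h := by
    intro y h h0 hd hy
    have hd1 := fun s (hs : s ∈ Set.Icc 0 h) =>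
      hasDerivAt_line (g := fun w : Vec d => f (y.1, y.2.1, w)) (v := y.2.2) (u := e) (s := s)
        (h2 _ (hy s ⟨hs.1, hs.2.trans hd⟩).1)
    have := abs_sub_sub_mul_deriv_le h0 (fun s hs => (hd1 s hs).1) (fun s hs => (hd1 s hs).2)
      (C := C) (fun s hs => by
        have h3 := iteratedFDeriv_two_eq_sum_hessV f (y.1, y.2.1, y.2.2 + s • e) e
        dsimp only at h3 ⊢
        rw [h3]
        exact (hy s ⟨hs.1, hs.2.trans hd⟩).2.le)
    simpa [inner_gradV] using this
  rw [Metric.continuousAt_iff']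
  intro ε hε
  -- Each of the two Taylor remainders costs at most `ε / 8` after division by `h`, and each of the
  -- two variations of `f` at most `ε / 4`; the total stays below `ε`.
  set h := min δ (ε / (8 * C))
  have hh : 0 < h := by positivity
  have hhC : C * h ≤ ε / 8 := by
    have : h ≤ ε / (8 * C) := min_le_right _ _
    rw [le_div_iff₀ (by positivity)] at this
    linarith
  have hzδ := hev.self_of_nhds
  have hcz : ContinuousAt f z := hf.continuousAt (hU.mem_nhds hz)
  have hch : ContinuousAt (fun y : Pt d => f (y.1, y.2.1, y.2.2 + h • e)) z := by
    have hm : (z.1, z.2.1, z.2.2 + h • e) ∈ U := (hzδ h ⟨hh.le, min_le_left _ _⟩).1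
    exact ContinuousAt.comp (f := fun y : Pt d => ((y.1, y.2.1, y.2.2 + h • e) : Pt d))
      (hf.continuousAt (hU.mem_nhds hm)) (by fun_prop)
  have hε' : 0 < ε * h / 4 := by positivity
  filter_upwards [hev, Metric.continuousAt_iff'.1 hcz _ hε', Metric.continuousAt_iff'.1 hch _ hε']
    with y hy hy1 hy2
  have t1 := abs_le.1 (taylor y h hh.le (min_le_left _ _) hy)
  have t2 := abs_le.1 (taylor z h hh.le (min_le_left _ _) hzδ)
  rw [Real.dist_eq, abs_lt] at hy1 hy2 ⊢
  have hCh : C * h * h ≤ ε / 8 * h := mul_le_mul_of_nonneg_right hhC hh.le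
  have a1 : h * (inner ℝ (gradV f y) e - inner ℝ (gradV f z) e) < h * ε := by linarith
  have a2 : h * (-ε) < h * (inner ℝ (gradV f y) e - inner ℝ (gradV f z) e) := by linarith
  exact ⟨lt_of_mul_lt_mul_left a2 hh.le, lt_of_mul_lt_mul_left a1 hh.le⟩

theorem continuousAt_gradV {d : ℕ} {f : Pt d → ℝ} {U : Set (Pt d)} (hU : IsOpen U)
    (hf : ContinuousOn f U)
    (h2 : ∀ z ∈ U, ContDiffAt ℝ 2 (fun w : Vec d => f (z.1, z.2.1, w)) z.2.2)
    (hH : ContinuousOn (hessV f) U) {z : Pt d} (hz : z ∈ U) :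
    ContinuousAt (gradV f) z := by
  have : gradV f = fun y => ∑ i, (inner ℝ (gradV f y) (EuclideanSpace.single i (1 : ℝ)) : ℝ) •
      EuclideanSpace.single i (1 : ℝ) := by
    funext y
    ext k
    simp [Finset.sum_apply, Pi.single_apply, EuclideanSpace.inner_single_right]
  rw [this]
  exact tendsto_finsetSum _ fun i _ =>
    (continuousAt_inner_gradV hU hf h2 hH hz _).smul continuousAt_const

/-! ### From almost everywhere bounds to pointwise inequalities. -/

instance isOpenPosMeasure_volume {d : ℕ} : (volume : Measure (Pt d)).IsOpenPosMeasure :=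
  haveI : (volume : Measure (Vec d × Vec d)).IsOpenPosMeasure := inferInstance
  Measure.prod.instIsOpenPosMeasure

/-- An almost everywhere bound on the source turns, by density, into a differential inequality
at every point, with nearby coefficients. -/
theorem exists_coeff_transport_le {d : ℕ} {lam Lam M : ℝ} {A : Pt d → Matrix (Fin d) (Fin d) ℝ}
    {B : Pt d → Vec d} {S f : Pt d → ℝ} {U : Set (Pt d)} (hU : IsOpen U) (hlam : 0 < lam)
    (hell : Elliptic lam Lam A B U) (hf : ContinuousOn f U)
    (h2 : ∀ z ∈ U, ContDiffAt ℝ 2 (fun w : Vec d => f (z.1, z.2.1, w)) z.2.2)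
    (hH : ContinuousOn (hessV f) U) (hT : ContinuousOn (transport f) U)
    (heq : ∀ z ∈ U, transport f z
      = (∑ i, ∑ j, A z i j * hessV f z i j) + inner ℝ (B z) (gradV f z) + S z)
    (hS : ∀ᵐ z ∂(volume.restrict U), S z ≤ M) {z : Pt d} (hz : z ∈ U) {ε : ℝ} (hε : 0 < ε) :
    ∃ (A' : Matrix (Fin d) (Fin d) ℝ) (B' : Vec d), A'.PosSemidef ∧
      (Lam • (1 : Matrix (Fin d) (Fin d) ℝ) - A').PosSemidef ∧
      ‖B'‖ ≤ Lam * (1 + ‖z.2.2‖ ^ 2) + ε ∧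
      transport f z ≤ (∑ i, ∑ j, A' i j * hessV f z i j) + inner ℝ B' (gradV f z) + M + ε := by
  have hUz := hU.mem_nhds hz
  have hA : ∀ y ∈ U, (A y).PosSemidef := fun y hy => by
    have := (hell y hy).2.1.add (Matrix.PosSemidef.one.smul hlam.le)
    simpa using this
  have hfreq : ∃ᶠ y in nhds z, y ∈ U ∧ S y ≤ M := by
    rw [ae_restrict_iff' hU.measurableSet] at hS
    have hd := (Measure.dense_of_ae hS z)
    rw [mem_closure_iff_frequently] at hd
    exact (hd.and_eventually hUz).mono fun y hy => ⟨hy.2, hy.1 hy.2⟩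
  have hHz : ∀ i j, ContinuousAt (fun y => hessV f y i j) z := fun i j =>
    continuousAt_pi.1 (continuousAt_pi.1 (hH.continuousAt hUz) i) j
  have hTz := hT.continuousAt hUz
  have hGz := continuousAt_gradV hU hf h2 hH hz
  have herr : ContinuousAt (fun y => (∑ i, ∑ j, |Lam| * |hessV f y i j - hessV f z i j|) +
      Lam * (1 + ‖y.2.2‖ ^ 2) * ‖gradV f y - gradV f z‖ + |transport f y - transport f z|) z := by
    refine ContinuousAt.add (ContinuousAt.add ?_ ?_) ?_
    · exact tendsto_finsetSum _ fun i _ => tendsto_finsetSum _ fun j _ =>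
        (((hHz i j).sub continuousAt_const).abs).const_mul _
    · exact ContinuousAt.mul (by fun_prop) (hGz.sub continuousAt_const).norm
    · exact (hTz.sub continuousAt_const).abs
  have hB : ContinuousAt (fun y : Pt d => Lam * (1 + ‖y.2.2‖ ^ 2)) z := by fun_prop
  have hB' := hB.eventually_lt_const (u := Lam * (1 + ‖z.2.2‖ ^ 2) + ε) (by linarith)
  have herr' := herr.eventually_lt_const (u := ε) (by simpa using hε)
  -- At `y` the bound on `S` holds and the derivatives of `f` are close to those at `z`. Only these
  -- are moved back to `z`; `A` and `B` stay frozen at `y`, so they need no continuity.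
  obtain ⟨y, ⟨hyU, hyS⟩, hy1, hy2⟩ := (hfreq.and_eventually (herr'.and hB')).exists
  obtain ⟨-, -, hL, hBy⟩ := hell y hyU
  refine ⟨A y, B y, hA y hyU, hL, hBy.trans hy2.le, ?_⟩
  have e1 := heq y hyU
  have e2 : (∑ i, ∑ j, A y i j * hessV f y i j) - (∑ i, ∑ j, A y i j * hessV f z i j) ≤
      ∑ i, ∑ j, |Lam| * |hessV f y i j - hessV f z i j| := by
    simp only [← Finset.sum_sub_distrib, ← mul_sub]
    refine Finset.sum_le_sum fun i _ => Finset.sum_le_sum fun j _ => (le_abs_self _).trans ?_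
    rw [abs_mul]
    exact mul_le_mul_of_nonneg_right
      ((abs_entry_le_of_posSemidef (hA y hyU) hL i j).trans (le_abs_self _)) (abs_nonneg _)
  have e3 : inner ℝ (B y) (gradV f y) - inner ℝ (B y) (gradV f z) ≤
      Lam * (1 + ‖y.2.2‖ ^ 2) * ‖gradV f y - gradV f z‖ := by
    rw [← inner_sub_right]
    exact (real_inner_le_norm _ _).trans (mul_le_mul_of_nonneg_right hBy (norm_nonneg _))
  have e4 := neg_abs_le (transport f y - transport f z)
  linarith

/-! ### Maximum principle at an interior point. -/

/-- One-sided, because the maximum will be taken over times up to a given one, so that only the past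
of the maximum point is available for comparison. -/
theorem nonneg_of_hasDerivAt_of_eventually_le_left {k : ℝ → ℝ} {k' a : ℝ} (hk : HasDerivAt k k' a)
    (hle : ∀ᶠ s in nhdsWithin a (Set.Iio a), k s ≤ k a) : 0 ≤ k' := by
  have h1 := (hasDerivAt_iff_tendsto_slope_left_right.1 hk).1
  refine ge_of_tendsto h1 ?_
  filter_upwards [hle, self_mem_nhdsWithin] with s hs hs'
  rw [slope_def_field]
  exact div_nonneg_of_nonpos (sub_nonpos.2 hs) (sub_nonpos.2 (le_of_lt hs'))

/-- The weight `α |v - v₀|² + p(t, x)`. -/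
noncomputable def weight {d : ℕ} (α : ℝ) (v₀ : Vec d) (p : ℝ × Vec d → ℝ) (z : Pt d) : ℝ :=
  α * ‖z.2.2 - v₀‖ ^ 2 + p (z.1, z.2.1)

/-- The function `f - F(w)`, for a weight `w` and an increasing convex `F` such that `F(w)` is a
strict supersolution at `z`, has no maximum at `z`. -/
theorem no_interior_max {d : ℕ} {lam Lam M : ℝ} {A : Pt d → Matrix (Fin d) (Fin d) ℝ}
    {B : Pt d → Vec d} {S f : Pt d → ℝ} {U : Set (Pt d)} (hU : IsOpen U) (hlam : 0 < lam)
    (hell : Elliptic lam Lam A B U) (hf : ContinuousOn f U)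
    (h2 : ∀ z ∈ U, ContDiffAt ℝ 2 (fun w : Vec d => f (z.1, z.2.1, w)) z.2.2)
    (hH : ContinuousOn (hessV f) U) (hT : ContinuousOn (transport f) U)
    (heq : ∀ z ∈ U, transport f z
      = (∑ i, ∑ j, A z i j * hessV f z i j) + inner ℝ (B z) (gradV f z) + S z)
    (hS : ∀ᵐ z ∂(volume.restrict U), S z ≤ M) {z : Pt d} (hz : z ∈ U)
    (hd : DifferentiableAt ℝ (fun s : ℝ => f (z.1 + s, z.2.1 + s • z.2.2, z.2.2)) 0)
    {F F₁ F₂ : ℝ → ℝ} (hF : ∀ s, HasDerivAt F (F₁ s) s) (hF₁ : ∀ s, HasDerivAt F₁ (F₂ s) s)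
    (hF₁0 : ∀ s, 0 ≤ F₁ s) (hF₂0 : ∀ s, 0 ≤ F₂ s) {α : ℝ} (hα : 0 ≤ α) {v₀ : Vec d}
    {p : ℝ × Vec d → ℝ} {T : ℝ}
    (hp : HasDerivAt (fun s : ℝ => p (z.1 + s, z.2.1 + s • z.2.2)) T 0)
    (hstrict : F₁ (weight α v₀ p z) * (2 * α * (d * Lam) +
        Lam * (1 + ‖z.2.2‖ ^ 2) * (2 * α * ‖z.2.2 - v₀‖)) +
        F₂ (weight α v₀ p z) * (4 * α ^ 2 * (Lam * ‖z.2.2 - v₀‖ ^ 2)) + M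
      < F₁ (weight α v₀ p z) * T)
    (hmaxv : IsLocalMax (fun v => f (z.1, z.2.1, v) - F (weight α v₀ p (z.1, z.2.1, v))) z.2.2)
    (hmaxt : ∀ᶠ s in nhdsWithin (0 : ℝ) (Set.Iio 0),
      f (z.1 + s, z.2.1 + s • z.2.2, z.2.2) -
        F (weight α v₀ p (z.1 + s, z.2.1 + s • z.2.2, z.2.2)) ≤ f z - F (weight α v₀ p z)) :
    False := by
  obtain ⟨t, x, v⟩ := z
  dsimp only at *
  set W := weight α v₀ p (t, x, v) with hW
  set ξ := v - v₀ with hξ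
  -- first order condition along the characteristic
  have htr : F₁ W * T ≤ transport f (t, x, v) := by
    have h1 : HasDerivAt (fun s : ℝ => weight α v₀ p (t + s, x + s • v, v)) T 0 := by
      simpa [weight] using hp.const_add (α * ‖v - v₀‖ ^ 2)
    have hW0 : weight α v₀ p (t + 0, x + (0 : ℝ) • v, v) = W := by simp [hW]
    have h3 : HasDerivAt (fun s : ℝ => F (weight α v₀ p (t + s, x + s • v, v))) (F₁ W * T) 0 :=
      HasDerivAt.comp (0 : ℝ) (h₂ := F) (by rw [hW0]; exact hF W) h1
    have h4 := hd.hasDerivAt.sub h3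
    have := nonneg_of_hasDerivAt_of_eventually_le_left h4 (by simpa [← hW] using hmaxt)
    simp only [transport]
    linarith
  -- first and second order conditions in the velocity
  have hdir : ∀ u : Vec d, inner ℝ (gradV f (t, x, v)) u = F₁ W * (2 * α * inner ℝ ξ u) ∧
      ∑ i, ∑ j, u i * u j * hessV f (t, x, v) i j ≤
        F₂ W * (2 * α * inner ℝ ξ u) ^ 2 + F₁ W * (2 * α * ‖u‖ ^ 2) := by
    intro u
    have hc : Filter.Tendsto (fun s : ℝ => v + s • u) (nhds 0) (nhds v) := by
      have : Continuous fun s : ℝ => v + s • u := by fun_prop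
      simpa using this.tendsto 0
    have hmax : IsLocalMax (fun s : ℝ => f (t, x, v + s • u) -
        F (weight α v₀ p (t, x, v + s • u))) 0 := by
      have := hc.eventually hmaxv
      simpa [IsLocalMax, IsMaxFilter] using this
    have hnear : ∀ᶠ s : ℝ in nhds 0, (t, x, v + s • u) ∈ U := by
      have : ContinuousAt (fun s : ℝ => ((t, x, v + s • u) : Pt d)) 0 := by fun_prop
      exact this (by simpa using hU.mem_nhds hz)
    have hw : ∀ s : ℝ, HasDerivAt (fun s : ℝ => weight α v₀ p (t, x, v + s • u))
        (2 * α * inner ℝ (v + s • u - v₀) u) s := by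
      intro s
      have hl : HasDerivAt (fun s : ℝ => v + s • u - v₀) u s := by
        simpa using (((hasDerivAt_id s).smul_const u).const_add v).sub_const v₀
      have := (hl.norm_sq.const_mul α).add_const (p (t, x))
      exact this.congr_deriv (by ring)
    have hw2 : HasDerivAt (fun s : ℝ => 2 * α * (inner ℝ (v + s • u - v₀) u : ℝ))
        (2 * α * ‖u‖ ^ 2) 0 := by
      have hl : HasDerivAt (fun s : ℝ => v + s • u - v₀) u 0 := by
        simpa using (((hasDerivAt_id (0 : ℝ)).smul_const u).const_add v).sub_const v₀
      have := (hl.inner ℝ (hasDerivAt_const (0 : ℝ) u)).const_mul (2 * α)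
      simpa using this
    have hd1 : ∀ᶠ s : ℝ in nhds 0, HasDerivAt (fun s : ℝ => f (t, x, v + s • u) -
        F (weight α v₀ p (t, x, v + s • u)))
        (fderiv ℝ (fun w : Vec d => f (t, x, w)) (v + s • u) u -
          F₁ (weight α v₀ p (t, x, v + s • u)) * (2 * α * inner ℝ (v + s • u - v₀) u)) s := by
      filter_upwards [hnear] with s hs
      have h1 := (hasDerivAt_line (g := fun w : Vec d => f (t, x, w)) (h2 _ hs)).1
      exact h1.sub (HasDerivAt.comp s (h₂ := F) (hF _) (hw s))
    have hd2 : HasDerivAt (fun s : ℝ => fderiv ℝ (fun w : Vec d => f (t, x, w)) (v + s • u) u -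
          F₁ (weight α v₀ p (t, x, v + s • u)) * (2 * α * inner ℝ (v + s • u - v₀) u))
        ((∑ i, ∑ j, u i * u j * hessV f (t, x, v) i j) -
          (F₂ W * (2 * α * inner ℝ ξ u) * (2 * α * inner ℝ ξ u) +
            F₁ W * (2 * α * ‖u‖ ^ 2))) 0 := by
      have h1 := (hasDerivAt_line (g := fun w : Vec d => f (t, x, w)) (v := v) (u := u) (s := 0)
        (by simpa using h2 _ hz)).2
      have h3 := iteratedFDeriv_two_eq_sum_hessV f (t, x, v) u
      dsimp only at h3
      have h4 : HasDerivAt (fun s : ℝ => F₁ (weight α v₀ p (t, x, v + s • u)))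
          (F₂ W * (2 * α * inner ℝ ξ u)) 0 := by
        have := HasDerivAt.comp (0 : ℝ) (h₂ := F₁) (hF₁ _) (hw 0)
        simpa [← hW, ← hξ, Function.comp_def] using this
      have h5 := h1.sub (h4.mul hw2)
      refine h5.congr_deriv ?_
      simp [h3, ← hW, ← hξ]
    constructor
    · have := hmax.hasDerivAt_eq_zero hd1.self_of_nhds
      rw [inner_gradV]
      simp only [zero_smul, add_zero, ← hW, ← hξ] at this
      dsimp only
      linarith
    · have := second_deriv_nonpos_of_isLocalMax hmax hd1 hd2
      linarith
  have hgrad : gradV f (t, x, v) = (F₁ W * (2 * α)) • ξ := by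
    refine ext_inner_right ℝ fun u => ?_
    rw [(hdir u).1, real_inner_smul_left]
    ring
  set K := 2 * α * ‖ξ‖ with hK
  have hK0 : 0 ≤ K := by positivity
  have hF1W := hF₁0 W
  have hF2W := hF₂0 W
  set gap := F₁ W * T - (F₁ W * (2 * α * (d * Lam) + Lam * (1 + ‖v‖ ^ 2) * K) +
        F₂ W * (4 * α ^ 2 * (Lam * ‖ξ‖ ^ 2)) + M) with hgap
  have hgap0 : 0 < gap := sub_pos.2 hstrict
  have hden : 0 < 1 + F₁ W * K := by positivity
  -- The error enters directly and through the drift, `ε (1 + F₁ K)` in total; this choice of `ε`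
  -- makes it half of the strictness gap.
  obtain ⟨A', B', hA', hLA', hB', hle⟩ := exists_coeff_transport_le hU hlam hell hf h2 hH hT heq hS
    hz (ε := gap / (2 * (1 + F₁ W * K))) (by positivity)
  set ε := gap / (2 * (1 + F₁ W * K)) with hε
  have hε' : ε * (1 + F₁ W * K) = gap / 2 := by rw [hε]; field_simp
  -- the second order term
  have hξn : ∑ i, ξ i ^ 2 = ‖ξ‖ ^ 2 := (EuclideanSpace.real_norm_sq_eq ξ).symm
  have hAH : ∑ i, ∑ j, A' i j * hessV f (t, x, v) i j ≤
      F₁ W * (2 * α * (d * Lam)) + F₂ W * (4 * α ^ 2 * (Lam * ‖ξ‖ ^ 2)) := by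
    -- The second order condition in all directions says that `4 α² F₂ ξ ξᵀ + 2 α F₁ I - D_v² f` is
    -- positive semidefinite, so its trace against `A'` is nonnegative.
    have h3 := sum_mul_nonneg_of_posSemidef hA' (P := Matrix.of fun i j =>
      F₂ W * (4 * α ^ 2) * (ξ i * ξ j) + F₁ W * (2 * α) * (if i = j then 1 else 0) -
        hessV f (t, x, v) i j) (fun u => by
        have h4 := (hdir (WithLp.toLp 2 u)).2
        rw [EuclideanSpace.real_norm_sq_eq, PiLp.inner_apply] at h4
        have h5 : ∑ i, ∑ j, u i * u j * (F₂ W * (4 * α ^ 2) * (ξ i * ξ j)) =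
            F₂ W * (2 * α * ∑ i, ξ i * u i) ^ 2 := by
          rw [mul_pow, sq (∑ i, ξ i * u i), Finset.sum_mul_sum, Finset.mul_sum, Finset.mul_sum]
          refine Finset.sum_congr rfl fun i _ => ?_
          rw [Finset.mul_sum, Finset.mul_sum]
          exact Finset.sum_congr rfl fun j _ => by ring
        have h6 : ∑ i, ∑ j, u i * u j * (F₁ W * (2 * α) * (if i = j then 1 else 0)) =
            F₁ W * (2 * α * ∑ i, u i ^ 2) := by
          simp only [mul_ite, mul_one, mul_zero, Finset.sum_ite_eq, Finset.mem_univ, if_true,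
            Finset.mul_sum]
          exact Finset.sum_congr rfl fun i _ => by ring
        simp only [Matrix.of_apply, mul_sub, mul_add, Finset.sum_sub_distrib,
          Finset.sum_add_distrib]
        rw [h5, h6]
        have h7 : ∀ i, (inner ℝ (ξ i) (u i) : ℝ) = ξ i * u i := fun i => by
          simp [mul_comm]
        simp only [h7] at h4
        linarith)
    simp only [Matrix.of_apply, mul_sub, mul_add, Finset.sum_sub_distrib,
      Finset.sum_add_distrib] at h3
    have h5 : ∑ i, ∑ j, A' i j * (F₂ W * (4 * α ^ 2) * (ξ i * ξ j)) =
        F₂ W * (4 * α ^ 2) * ∑ i, ∑ j, A' i j * (ξ i * ξ j) := by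
      simp only [Finset.mul_sum]
      exact Finset.sum_congr rfl fun i _ => Finset.sum_congr rfl fun j _ => by ring
    have h6 : ∑ i, ∑ j, A' i j * (F₁ W * (2 * α) * (if i = j then 1 else 0)) =
        F₁ W * (2 * α) * ∑ i, A' i i := by
      simp only [mul_ite, mul_one, mul_zero, Finset.sum_ite_eq, Finset.mem_univ, if_true,
        Finset.mul_sum]
      exact Finset.sum_congr rfl fun i _ => by ring
    rw [h5, h6] at h3
    have h7 := mul_le_mul_of_nonneg_left (quadForm_le_of_posSemidef hLA' ξ)
      (show 0 ≤ F₂ W * (4 * α ^ 2) by positivity)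
    have h8 := mul_le_mul_of_nonneg_left (trace_le_of_posSemidef hLA')
      (show 0 ≤ F₁ W * (2 * α) by positivity)
    rw [hξn] at h7
    linarith
  have hBg : inner ℝ B' (gradV f (t, x, v)) ≤ (Lam * (1 + ‖v‖ ^ 2) + ε) * (F₁ W * K) := by
    refine (real_inner_le_norm _ _).trans ?_
    have : ‖gradV f (t, x, v)‖ = F₁ W * K := by
      rw [hgrad, norm_smul, Real.norm_of_nonneg (by positivity)]
      ring
    rw [this]
    exact mul_le_mul_of_nonneg_right hB' (by positivity)
  linarith

/-! ### Comparison with the barrier in a box. -/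

theorem isOpen_locDomInt {d : ℕ} {Ω : Set (Vec d)} (hΩ : IsOpen Ω) (r : ℝ) (z₀ : Pt d) :
    IsOpen (locDomInt Ω r z₀) := by
  have : locDomInt Ω r z₀ = {z : Pt d | z₀.1 - r ^ 2 < z.1} ∩
      {z | ‖z.2.1 - z₀.2.1 - (z.1 - z₀.1) • z₀.2.2‖ < r ^ 3} ∩ {z | ‖z.2.2 - z₀.2.2‖ < r} ∩
      {z | z.1 < z₀.1} ∩ {z | z.2.1 ∈ Ω} := by
    ext z
    simp only [locDomInt, cyl, Set.mem_ofPred_eq, Set.mem_inter_iff]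
    constructor
    · rintro ⟨⟨h1, h2, h3, h4⟩, h5, h6⟩
      exact ⟨⟨⟨⟨h1, h3⟩, h4⟩, h5⟩, h6⟩
    · rintro ⟨⟨⟨⟨h1, h3⟩, h4⟩, h5⟩, h6⟩
      exact ⟨⟨h1, h5.le, h3, h4⟩, h5, h6⟩
  rw [this]
  refine (((IsOpen.inter ?_ ?_).inter ?_).inter ?_).inter (hΩ.preimage (by fun_prop))
  · exact isOpen_lt continuous_const (by fun_prop)
  · exact isOpen_lt (by fun_prop) continuous_const
  · exact isOpen_lt (by fun_prop) continuous_const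
  · exact isOpen_lt (by fun_prop) continuous_const

/-- The closed box of size `b` in velocity and position and of duration `b²`, cut by `Ω`. -/
def box {d : ℕ} (Ω : Set (Vec d)) (b : ℝ) (z₀ : Pt d) : Set (Pt d) :=
  {z | z₀.1 - b ^ 2 ≤ z.1 ∧ z.1 ≤ z₀.1 ∧ ‖z.2.1 - z₀.2.1‖ ≤ b ∧ z.2.1 ∈ closure Ω ∧
    ‖z.2.2 - z₀.2.2‖ ≤ b}

/-- The part of the barrier that depends on time and position. -/
noncomputable def posWeight {d : ℕ} (b κ t₀ : ℝ) (x₀ : Vec d) (ψ : Vec d → ℝ)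
    (y : ℝ × Vec d) : ℝ :=
  (b ^ 2)⁻¹ * (‖y.2 - x₀‖ ^ 2 + (t₀ - y.1)) + κ * ψ y.2

theorem hasDerivAt_posWeight {d : ℕ} {b κ t₀ : ℝ} {x₀ : Vec d} {ψ : Vec d → ℝ}
    (hψ : Differentiable ℝ ψ) (t : ℝ) (x v : Vec d) :
    HasDerivAt (fun s : ℝ => posWeight b κ t₀ x₀ ψ (t + s, x + s • v))
      ((b ^ 2)⁻¹ * (2 * inner ℝ (x - x₀) v - 1) + κ * fderiv ℝ ψ x v) 0 := by
  have hl : HasDerivAt (fun s : ℝ => x + s • v) v 0 := by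
    simpa using ((hasDerivAt_id (0 : ℝ)).smul_const v).const_add x
  have h1 := (hl.sub_const x₀).norm_sq
  have h2 : HasDerivAt (fun s : ℝ => t₀ - (t + s)) (-1) 0 := by
    simpa using ((hasDerivAt_id (0 : ℝ)).const_add t).const_sub t₀
  have h3 : HasDerivAt (fun s : ℝ => ψ (x + s • v)) (fderiv ℝ ψ x v) 0 := by
    have := (hψ (x + (0 : ℝ) • v)).hasFDerivAt.comp_hasDerivAt (0 : ℝ) hl
    simpa [Function.comp_def] using this
  have := ((h1.add h2).const_mul (b ^ 2)⁻¹).add (h3.const_mul κ)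
  refine this.congr_deriv ?_
  rw [zero_smul, add_zero]
  ring

/-- Comparison with the barrier `F(w)` in the box. -/
theorem le_barrier {d : ℕ} {Ω : Set (Vec d)} (hΩ : IsOpen Ω) {lam Lam M N b κ t₀ : ℝ}
    {x₀ v₀ : Vec d} {A : Pt d → Matrix (Fin d) (Fin d) ℝ} {B : Pt d → Vec d} {S f : Pt d → ℝ}
    (hlam : 0 < lam) (hell : Elliptic lam Lam A B (locDomInt Ω 2 (t₀, x₀, v₀)))
    (hsol : IsSolution Ω A B S 2 (t₀, x₀, v₀) f)
    (hS : ∀ᵐ z ∂(volume.restrict (locDomInt Ω 2 (t₀, x₀, v₀))), S z ≤ M)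
    (hb : 0 < b) (hcyl : box Ω b (t₀, x₀, v₀) ⊆ cyl 2 (t₀, x₀, v₀))
    {ψ : Vec d → ℝ} (hψ : Differentiable ℝ ψ) (hκ : 0 ≤ κ)
    (hψ0 : ∀ z ∈ box Ω b (t₀, x₀, v₀), 0 ≤ ψ z.2.1)
    (hin : ∀ z ∈ box Ω b (t₀, x₀, v₀), z.2.1 ∈ frontier Ω → z ∈ incoming Ω)
    (hfN : ∀ z ∈ box Ω b (t₀, x₀, v₀), f z ≤ N)
    {F F₁ F₂ : ℝ → ℝ} (hF : ∀ s, HasDerivAt F (F₁ s) s) (hF₁ : ∀ s, HasDerivAt F₁ (F₂ s) s)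
    (hF₁0 : ∀ s, 0 ≤ F₁ s) (hF₂0 : ∀ s, 0 ≤ F₂ s) (hFzero : 0 ≤ F 0) (hFone : N ≤ F 1)
    (hstrict : ∀ z ∈ box Ω b (t₀, x₀, v₀),
      F₁ (weight (b ^ 2)⁻¹ v₀ (posWeight b κ t₀ x₀ ψ) z) * (2 * (b ^ 2)⁻¹ * (d * Lam) +
        Lam * (1 + ‖z.2.2‖ ^ 2) * (2 * (b ^ 2)⁻¹ * ‖z.2.2 - v₀‖)) +
        F₂ (weight (b ^ 2)⁻¹ v₀ (posWeight b κ t₀ x₀ ψ) z) *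
          (4 * (b ^ 2)⁻¹ ^ 2 * (Lam * ‖z.2.2 - v₀‖ ^ 2)) + M
      < F₁ (weight (b ^ 2)⁻¹ v₀ (posWeight b κ t₀ x₀ ψ) z) *
        ((b ^ 2)⁻¹ * (2 * inner ℝ (z.2.1 - x₀) z.2.2 - 1) + κ * fderiv ℝ ψ z.2.1 z.2.2))
    {z : Pt d} (hz : z ∈ box Ω b (t₀, x₀, v₀)) :
    f z ≤ F (weight (b ^ 2)⁻¹ v₀ (posWeight b κ t₀ x₀ ψ) z) := by
  set W := weight (b ^ 2)⁻¹ v₀ (posWeight b κ t₀ x₀ ψ) with hW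
  have hFmono : Monotone F := monotone_of_deriv_nonneg (fun s => (hF s).differentiableAt)
    fun s => by rw [(hF s).deriv]; exact hF₁0 s
  have hFc : Continuous F := continuous_iff_continuousAt.2 fun s => (hF s).continuousAt
  have hψc : Continuous ψ := hψ.continuous
  have hWc : Continuous W := by
    unfold W weight posWeight
    fun_prop
  have hb2 : 0 < b ^ 2 := by positivity
  have hWeq : ∀ z : Pt d, W z = (b ^ 2)⁻¹ * (‖z.2.2 - v₀‖ ^ 2 + ‖z.2.1 - x₀‖ ^ 2 + (t₀ - z.1)) +
      κ * ψ z.2.1 := fun z => by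
    simp only [hW, weight, posWeight]; ring
  have hWge : ∀ z ∈ box Ω b (t₀, x₀, v₀),
      (b ^ 2)⁻¹ * (‖z.2.2 - v₀‖ ^ 2 + ‖z.2.1 - x₀‖ ^ 2 + (t₀ - z.1)) ≤ W z := fun z hz => by
    rw [hWeq]
    have := mul_nonneg hκ (hψ0 z hz)
    linarith
  have hW0 : ∀ z ∈ box Ω b (t₀, x₀, v₀), 0 ≤ W z := fun z hz => by
    refine le_trans ?_ (hWge z hz)
    have : 0 ≤ t₀ - z.1 := sub_nonneg.2 hz.2.1
    positivity
  have hFW0 : ∀ z ∈ box Ω b (t₀, x₀, v₀), 0 ≤ F (W z) := fun z hz =>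
    hFzero.trans (hFmono (hW0 z hz))
  have hfront : ∀ z ∈ box Ω b (t₀, x₀, v₀), z.2.1 ∈ frontier Ω → f z ≤ F (W z) := fun z hz hzf => by
    rw [hsol.boundary z ⟨hin z hz hzf, hcyl hz⟩]
    exact hFW0 z hz
  -- On the sides of the box and at its initial time the quadratic part of the weight alone reaches
  -- 1, where `F` dominates `N`.
  have hside : ∀ z ∈ box Ω b (t₀, x₀, v₀),
      b ^ 2 ≤ ‖z.2.2 - v₀‖ ^ 2 + ‖z.2.1 - x₀‖ ^ 2 + (t₀ - z.1) → f z ≤ F (W z) := fun z hz h => by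
    refine (hfN z hz).trans (hFone.trans (hFmono (le_trans ?_ (hWge z hz))))
    rw [inv_mul_eq_div, le_div_iff₀ hb2]
    linarith
  have hdom : ∀ z ∈ box Ω b (t₀, x₀, v₀), z ∈ locDomInner Ω 2 (t₀, x₀, v₀) ∨
      z ∈ incoming Ω ∩ cyl 2 (t₀, x₀, v₀) := fun z hz => by
    by_cases hx : z.2.1 ∈ Ω
    · exact Or.inl ⟨hcyl hz, hx⟩
    · refine Or.inr ⟨hin z hz ⟨hz.2.2.2.1, ?_⟩, hcyl hz⟩
      rwa [hΩ.interior_eq]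
  have hkc : ContinuousOn (fun z => f z - F (W z)) (box Ω b (t₀, x₀, v₀)) :=
    (hsol.continuousOn.mono hdom).sub (hFc.comp hWc).continuousOn
  -- times before the final time
  have hmain : ∀ z ∈ box Ω b (t₀, x₀, v₀), z.1 < t₀ → f z ≤ F (W z) := by
    intro zs hzs hlt
    by_contra! hpos
    -- Stopping at the time of `zs`, before `t₀`, makes the set compact and keeps its maximum points
    -- at times where the equation holds.
    set D : Set (Pt d) := Set.Icc (t₀ - b ^ 2) zs.1 ×ˢ
      ((Metric.closedBall x₀ b ∩ closure Ω) ×ˢ Metric.closedBall v₀ b) with hD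
    have hDc : IsCompact D := isCompact_Icc.prod
      (((isCompact_closedBall x₀ b).inter_right isClosed_closure).prod (isCompact_closedBall v₀ b))
    have hDbox : ∀ z, z ∈ D ↔ z ∈ box Ω b (t₀, x₀, v₀) ∧ z.1 ≤ zs.1 := fun z => by
      simp only [hD, box, Set.mem_prod, Set.mem_Icc, Set.mem_inter_iff, Metric.mem_closedBall,
        dist_eq_norm, Set.mem_ofPred_eq]
      constructor
      · rintro ⟨⟨h1, h2⟩, ⟨h3, h4⟩, h5⟩
        exact ⟨⟨h1, h2.trans hlt.le, h3, h4, h5⟩, h2⟩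
      · rintro ⟨⟨h1, -, h3, h4, h5⟩, h2⟩
        exact ⟨⟨h1, h2⟩, ⟨h3, h4⟩, h5⟩
    have hzD : zs ∈ D := (hDbox zs).2 ⟨hzs, le_rfl⟩
    obtain ⟨z₁, hz₁, hmax⟩ := hDc.exists_isMaxOn ⟨zs, hzD⟩
      (hkc.mono fun z hz => ((hDbox z).1 hz).1)
    obtain ⟨hz₁b, hz₁t⟩ := (hDbox z₁).1 hz₁
    have hpos₁ : F (W z₁) < f z₁ := by
      have := hmax hzD
      simp only [Set.mem_ofPred_eq] at this
      linarith
    have hxΩ : z₁.2.1 ∈ Ω := by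
      by_contra hx
      refine absurd (hfront z₁ hz₁b ⟨hz₁b.2.2.2.1, ?_⟩) (not_le.2 hpos₁)
      rwa [hΩ.interior_eq]
    have hns : ‖z₁.2.2 - v₀‖ ^ 2 + ‖z₁.2.1 - x₀‖ ^ 2 + (t₀ - z₁.1) < b ^ 2 := by
      by_contra! h
      exact absurd (hside z₁ hz₁b h) (not_le.2 hpos₁)
    have ht0 : 0 ≤ t₀ - z₁.1 := sub_nonneg.2 hz₁b.2.1
    have hvb : ‖z₁.2.2 - v₀‖ < b := lt_of_pow_lt_pow_left₀ 2 hb.le (by nlinarith)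
    have hxb : ‖z₁.2.1 - x₀‖ < b := lt_of_pow_lt_pow_left₀ 2 hb.le (by nlinarith)
    have htb : t₀ - b ^ 2 < z₁.1 := by nlinarith [sq_nonneg ‖z₁.2.2 - v₀‖, sq_nonneg ‖z₁.2.1 - x₀‖]
    have hz₁U : z₁ ∈ locDomInt Ω 2 (t₀, x₀, v₀) := ⟨hcyl hz₁b, hz₁t.trans_lt hlt, hxΩ⟩
    have hUin : locDomInt Ω 2 (t₀, x₀, v₀) ⊆
        locDomInner Ω 2 (t₀, x₀, v₀) ∪ incoming Ω ∩ cyl 2 (t₀, x₀, v₀) :=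
      fun z hz => Or.inl ⟨hz.1, hz.2.2⟩
    refine no_interior_max (isOpen_locDomInt hΩ 2 (t₀, x₀, v₀)) hlam hell
      (hsol.continuousOn.mono hUin) hsol.contDiffAt_v hsol.continuousOn_hessV
      hsol.continuousOn_transport hsol.equation hS hz₁U (hsol.differentiableAt_transport z₁ hz₁U)
      hF hF₁ hF₁0 hF₂0 (inv_nonneg.2 hb2.le) (hasDerivAt_posWeight hψ _ _ _)
      (hstrict z₁ hz₁b) ?_ ?_
    · have : ∀ᶠ v in nhds z₁.2.2, ‖v - v₀‖ < b :=
        (by fun_prop : Continuous fun v : Vec d => ‖v - v₀‖).continuousAt.eventually_lt_const hvb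
      filter_upwards [this] with v hv
      exact hmax ((hDbox (z₁.1, z₁.2.1, v)).2
        ⟨⟨hz₁b.1, hz₁b.2.1, hz₁b.2.2.1, hz₁b.2.2.2.1, hv.le⟩, hz₁t⟩)
    · have c1 : ContinuousAt (fun s : ℝ => z₁.1 + s) 0 := by fun_prop
      have c2 : ContinuousAt (fun s : ℝ => z₁.2.1 + s • z₁.2.2) 0 := by fun_prop
      have c3 : ContinuousAt (fun s : ℝ => ‖z₁.2.1 + s • z₁.2.2 - x₀‖) 0 := by fun_prop
      have e1 : ∀ᶠ s in nhds (0 : ℝ), t₀ - b ^ 2 < z₁.1 + s :=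
        c1.eventually_const_lt (by simpa using htb)
      have e2 : ∀ᶠ s in nhds (0 : ℝ), z₁.2.1 + s • z₁.2.2 ∈ Ω :=
        c2 (hΩ.mem_nhds (by simpa using hxΩ))
      have e3 : ∀ᶠ s in nhds (0 : ℝ), ‖z₁.2.1 + s • z₁.2.2 - x₀‖ < b :=
        c3.eventually_lt_const (by simpa using hxb)
      filter_upwards [nhdsWithin_le_nhds e1, nhdsWithin_le_nhds e2, nhdsWithin_le_nhds e3,
        self_mem_nhdsWithin] with s h1 h2 h3 h4
      have h4' : s < 0 := h4
      exact hmax ((hDbox (z₁.1 + s, z₁.2.1 + s • z₁.2.2, z₁.2.2)).2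
        ⟨⟨h1.le, (by linarith : z₁.1 + s ≤ t₀), h3.le, subset_closure h2, hvb.le⟩,
          (by linarith : z₁.1 + s ≤ zs.1)⟩)
  rcases lt_or_eq_of_le (show z.1 ≤ t₀ from hz.2.1) with hlt | heq
  · exact hmain z hz hlt
  · obtain ⟨t, x, v⟩ := z
    dsimp only at heq
    subst heq
    -- The equation is not available at the final time; the inequality passes to the limit along
    -- earlier times at fixed `x` and `v`.
    have hpath : ∀ s ∈ Set.Ico (t - b ^ 2) t, (s, x, v) ∈ box Ω b (t, x₀, v₀) := fun s hs =>
      ⟨hs.1, hs.2.le, hz.2.2.1, hz.2.2.2.1, hz.2.2.2.2⟩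
    have hev : ∀ᶠ s in nhdsWithin t (Set.Iio t), s ∈ Set.Ico (t - b ^ 2) t :=
      Ico_mem_nhdsLT (by linarith)
    have hlim : Filter.Tendsto (fun s : ℝ => ((s, x, v) : Pt d)) (nhdsWithin t (Set.Iio t))
        (nhdsWithin (t, x, v) (box Ω b (t, x₀, v₀))) := by
      refine tendsto_nhdsWithin_iff.2 ⟨?_, hev.mono hpath⟩
      exact ((by fun_prop : Continuous fun s : ℝ => ((s, x, v) : Pt d)).tendsto t).mono_left
        nhdsWithin_le_nhds
    have := le_of_tendsto ((hkc _ hz).tendsto.comp hlim) (b := 0)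
      (hev.mono fun s hs => sub_nonpos.2 (hmain _ (hpath s hs) hs.2))
    linarith

/-! ### Defining functions, the outward normal and the incoming boundary. -/

/-- `ψ` is a `C^{1,1}` defining function of `Ω` in the ball of radius `r` about `x₀`, with
constants controlled by `K`. -/
structure IsDefining {d : ℕ} (Ω : Set (Vec d)) (r K : ℝ) (x₀ : Vec d) (ψ : Vec d → ℝ) :
    Prop where
  differentiable : Differentiable ℝ ψ
  lipschitz : ∀ x y, ‖fderiv ℝ ψ x - fderiv ℝ ψ y‖ ≤ K * ‖x - y‖
  norm_le : ‖fderiv ℝ ψ x₀‖ ≤ K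
  one_le_norm : ∀ x, 1 ≤ ‖fderiv ℝ ψ x‖
  mem_iff : ∀ x ∈ Metric.ball x₀ r, (x ∈ Ω ↔ 0 < ψ x)

theorem IsDefining.mono {d : ℕ} {Ω : Set (Vec d)} {r K r' K' : ℝ} {x₀ : Vec d} {ψ : Vec d → ℝ}
    (h : IsDefining Ω r K x₀ ψ) (hr : r' ≤ r) (hK : K ≤ K') : IsDefining Ω r' K' x₀ ψ :=
  ⟨h.differentiable, fun x y => (h.lipschitz x y).trans
      (mul_le_mul_of_nonneg_right hK (norm_nonneg _)),
    h.norm_le.trans hK, h.one_le_norm, fun x hx => h.mem_iff x (Metric.ball_subset_ball hr hx)⟩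

/-- The function `γ(P x) - ⟨e, x⟩` has derivative `-1` along `e`, because `P e = 0`; hence its
gradient has norm at least 1 everywhere. Halving the radius lets one graph serve all nearby centres.
-/
theorem exists_isDefining_of_graph {d : ℕ} {Ω : Set (Vec d)} {y e : Vec d} (he : ‖e‖ = 1)
    {γ : (Submodule.span ℝ {e})ᗮ → ℝ} (hγ : ContDiff ℝ 1 γ) {K : NNReal}
    (hK : LipschitzWith K (fderiv ℝ γ)) {r : ℝ} (hr : 0 < r)
    (hΩ : ∀ x ∈ Metric.ball y r,
      (x ∈ Ω ↔ inner ℝ e x < γ ((Submodule.span ℝ {e})ᗮ.orthogonalProjectionOnto x))) :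
    ∃ K' : ℝ, ∀ x₀ ∈ Metric.ball y (r / 2), ∃ ψ, IsDefining Ω (r / 2) K' x₀ ψ := by
  set P := (Submodule.span ℝ {e})ᗮ.orthogonalProjectionOnto with hP
  set ψ : Vec d → ℝ := fun x => γ (P x) - inner ℝ e x with hψ
  have hγd : Differentiable ℝ γ := hγ.differentiable (by norm_num)
  have hfd : ∀ x, HasFDerivAt ψ ((fderiv ℝ γ (P x)).comp P - innerSL ℝ e) x := fun x =>
    ((hγd (P x)).hasFDerivAt.comp x P.hasFDerivAt).sub (innerSL ℝ e).hasFDerivAt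
  have hfd' : ∀ x, fderiv ℝ ψ x = (fderiv ℝ γ (P x)).comp P - innerSL ℝ e := fun x =>
    (hfd x).fderiv
  have hPn : ‖P‖ ≤ 1 := Submodule.orthogonalProjectionOnto_norm_le _
  have hPe : P e = 0 := by
    rw [hP, Submodule.orthogonalProjectionOnto_eq_zero_iff]
    exact Submodule.le_orthogonal_orthogonal _ (Submodule.mem_span_singleton_self e)
  have hlip : ∀ x z, ‖fderiv ℝ ψ x - fderiv ℝ ψ z‖ ≤ K * ‖x - z‖ := fun x z => by
    rw [hfd', hfd', sub_sub_sub_cancel_right, ← ContinuousLinearMap.sub_comp]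
    refine (ContinuousLinearMap.opNorm_comp_le _ _).trans ?_
    have h1 : ‖fderiv ℝ γ (P x) - fderiv ℝ γ (P z)‖ ≤ K * ‖P x - P z‖ := by
      simpa [dist_eq_norm] using hK.dist_le_mul (P x) (P z)
    have h2 : ‖P x - P z‖ ≤ ‖x - z‖ := by
      rw [← map_sub]
      refine (P.le_opNorm _).trans ?_
      exact mul_le_of_le_one_left (norm_nonneg _) hPn
    calc _ ≤ ‖fderiv ℝ γ (P x) - fderiv ℝ γ (P z)‖ * 1 :=
          by gcongr
      _ ≤ _ := by
          rw [mul_one]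
          exact h1.trans (mul_le_mul_of_nonneg_left h2 K.2)
  refine ⟨K + ‖fderiv ℝ ψ y‖ + K * r, fun x₀ hx₀ => ⟨ψ, fun x => (hfd x).differentiableAt,
    fun x z => (hlip x z).trans ?_, ?_, fun x => ?_, fun x hx => ?_⟩⟩
  · refine mul_le_mul_of_nonneg_right ?_ (norm_nonneg _)
    have : 0 ≤ K * r := by positivity
    linarith [norm_nonneg (fderiv ℝ ψ y)]
  · have h1 := norm_le_norm_add_norm_sub' (fderiv ℝ ψ x₀) (fderiv ℝ ψ y)
    have h2 := hlip x₀ y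
    have h3 : ‖x₀ - y‖ ≤ r := by
      rw [Metric.mem_ball, dist_eq_norm] at hx₀; linarith
    have h4 : K * ‖x₀ - y‖ ≤ K * r := mul_le_mul_of_nonneg_left h3 K.2
    linarith [K.2]
  · have h1 : fderiv ℝ ψ x e = -1 := by
      rw [hfd']
      simp [hPe, he]
    have h2 := (fderiv ℝ ψ x).le_opNorm e
    rw [h1, he] at h2
    simpa using h2
  · rw [hΩ x, hψ]
    · exact sub_pos.symm
    · have := Metric.mem_ball.1 hx
      have := Metric.mem_ball.1 hx₀
      exact Metric.mem_ball.2 ((dist_triangle x x₀ y).trans_lt (by linarith))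

/-- Compactness of the boundary makes the radius and the constant independent of `x₀`, so that they
depend on `Ω` alone. -/
theorem exists_uniform_isDefining {d : ℕ} {Ω : Set (Vec d)} (hb : Bornology.IsBounded Ω)
    (hΩ : HasC11Boundary Ω) :
    ∃ r > 0, ∃ K : ℝ, ∀ x₀ ∈ frontier Ω, ∃ ψ, IsDefining Ω r K x₀ ψ := by
  have hc : IsCompact (frontier Ω) :=
    hb.isCompact_closure.of_isClosed_subset isClosed_frontier frontier_subset_closure
  refine hc.induction_on (p := fun s => ∃ r > 0, ∃ K : ℝ, ∀ x₀ ∈ s, ∃ ψ, IsDefining Ω r K x₀ ψ)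
    ⟨1, one_pos, 0, by simp⟩ ?_ ?_ ?_
  · rintro s t hst ⟨r, hr, K, h⟩
    exact ⟨r, hr, K, fun x hx => h x (hst hx)⟩
  · rintro s t ⟨r, hr, K, h⟩ ⟨r', hr', K', h'⟩
    refine ⟨min r r', lt_min hr hr', max K K', fun x hx => ?_⟩
    rcases hx with hx | hx
    · obtain ⟨ψ, hψ⟩ := h x hx
      exact ⟨ψ, hψ.mono (min_le_left _ _) (le_max_left _ _)⟩
    · obtain ⟨ψ, hψ⟩ := h' x hx
      exact ⟨ψ, hψ.mono (min_le_right _ _) (le_max_right _ _)⟩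
  · intro y hy
    obtain ⟨e, he, γ, hγ, ⟨K, hK⟩, r, hr, hgr⟩ := hΩ y hy
    obtain ⟨K', h⟩ := exists_isDefining_of_graph he hγ hK hr hgr
    exact ⟨_, mem_nhdsWithin_of_mem_nhds (Metric.ball_mem_nhds y (half_pos hr)), r / 2,
      half_pos hr, K', h⟩

section LocalGeometry

variable {d : ℕ} {Ω : Set (Vec d)} {x : Vec d} {ψ : Vec d → ℝ}

theorem nonneg_of_mem_closure (hψ : ContinuousAt ψ x)
    (hloc : ∀ᶠ y in nhds x, (y ∈ Ω ↔ 0 < ψ y)) (hx : x ∈ closure Ω) : 0 ≤ ψ x := by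
  by_contra! h
  have h1 := hψ.eventually_lt_const h
  obtain ⟨y, hy, hy1, hy2⟩ := ((mem_closure_iff_frequently.1 hx).and_eventually
    (h1.and hloc)).exists
  linarith [hy2.1 hy]

theorem eq_zero_of_mem_frontier (hΩ : IsOpen Ω) (hψ : ContinuousAt ψ x)
    (hloc : ∀ᶠ y in nhds x, (y ∈ Ω ↔ 0 < ψ y)) (hx : x ∈ frontier Ω) : ψ x = 0 := by
  refine le_antisymm (not_lt.1 fun h => ?_)
    (nonneg_of_mem_closure hψ hloc (frontier_subset_closure hx))
  rw [hΩ.frontier_eq] at hx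
  exact hx.2 (hloc.self_of_nhds.2 h)

/-- With `p = ∇ψ(x)`, every `w` with `⟨p, w⟩ > 0` points into `Ω`, hence `⟨w, n⟩ ≤ 0`. The choice `w
= ‖p‖ n + p` then forces `⟨p, n⟩ ≤ -‖p‖`, the equality case of Cauchy–Schwarz, so `p = -‖p‖ n`. -/
theorem fderiv_eq_of_isOuterUnitNormal (hψ : DifferentiableAt ℝ ψ x)
    (hloc : ∀ᶠ y in nhds x, (y ∈ Ω ↔ 0 < ψ y)) (h0 : ψ x = 0) {n : Vec d}
    (hn : IsOuterUnitNormal Ω x n) (w : Vec d) :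
    fderiv ℝ ψ x w = -‖fderiv ℝ ψ x‖ * inner ℝ n w := by
  set p : Vec d := (InnerProductSpace.toDual ℝ (Vec d)).symm (fderiv ℝ ψ x) with hp
  have hpw : ∀ w, inner ℝ p w = fderiv ℝ ψ x w := fun w => by simp [hp]
  have hpn : ‖p‖ = ‖fderiv ℝ ψ x‖ := by simp [hp]
  have key : ∀ w, 0 < inner ℝ p w → (inner ℝ w n : ℝ) ≤ 0 := fun w hw => by
    have hl : HasDerivAt (fun s : ℝ => x + s • w) w 0 := by
      simpa using ((hasDerivAt_id (0 : ℝ)).smul_const w).const_add x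
    have hd : HasDerivAt (fun s : ℝ => ψ (x + s • w)) (inner ℝ p w) 0 := by
      rw [hpw]
      have := HasFDerivAt.comp_hasDerivAt (0 : ℝ) (f := fun s : ℝ => x + s • w)
        (l := ψ) (by simpa using hψ.hasFDerivAt) hl
      exact this
    have hslope := (hasDerivAt_iff_tendsto_slope_left_right.1 hd).2.eventually_const_lt hw
    have hcont : Filter.Tendsto (fun s : ℝ => x + s • w) (nhds 0) (nhds x) := by
      simpa using hl.continuousAt.tendsto
    have hmem : ∀ᶠ s in nhdsWithin (0 : ℝ) (Set.Ioi 0), x + s • w ∈ Ω := by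
      filter_upwards [hslope, nhdsWithin_le_nhds (hcont.eventually hloc), self_mem_nhdsWithin]
        with s h1 h2 h3
      have h3' : 0 < s := h3
      rw [h2]
      rw [slope_def_field] at h1
      simp only [zero_smul, add_zero, h0, sub_zero] at h1
      exact (div_pos_iff_of_pos_right h3').1 h1
    have hlim : Filter.Tendsto (fun s : ℝ => x + s • w) (nhdsWithin 0 (Set.Ioi 0))
        (nhdsWithin x Ω) :=
      tendsto_nhdsWithin_iff.2 ⟨hcont.mono_left nhdsWithin_le_nhds, hmem⟩
    refine le_of_forall_pos_le_add fun ε hε => ?_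
    rw [zero_add]
    have hev := hlim.eventually (hn.2 (ε / (1 + ‖w‖)) (by positivity))
    obtain ⟨s, hs, hs0⟩ := (hev.and self_mem_nhdsWithin).exists
    have hs0' : 0 < s := hs0
    rw [add_sub_cancel_left, real_inner_smul_left, norm_smul, Real.norm_of_nonneg hs0'.le] at hs
    have h1 : inner ℝ w n ≤ ε / (1 + ‖w‖) * ‖w‖ :=
      le_of_mul_le_mul_left (by linarith) hs0'
    refine h1.trans ?_
    rw [div_mul_eq_mul_div, div_le_iff₀ (by positivity)]
    nlinarith [norm_nonneg w]
  have hle : inner ℝ p n ≤ -‖p‖ := by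
    by_contra! h
    have hp0 : 0 < ‖p‖ := by
      by_contra! h0
      have : p = 0 := norm_le_zero_iff.1 h0
      simp [this] at h
    have h1 := key (‖p‖ • n + p) (by
      rw [inner_add_right, real_inner_smul_right, real_inner_self_eq_norm_sq]
      nlinarith)
    rw [inner_add_left, real_inner_smul_left, real_inner_self_eq_norm_sq, hn.1] at h1
    linarith
  have hzero : p + ‖p‖ • n = 0 := by
    have : ‖p + ‖p‖ • n‖ ^ 2 ≤ 0 := by
      rw [norm_add_sq_real, real_inner_smul_right, norm_smul, hn.1, norm_norm]
      nlinarith [norm_nonneg p]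
    exact norm_eq_zero.1 (pow_eq_zero_iff two_ne_zero |>.1 (le_antisymm this (by positivity)))
  rw [← hpw, eq_neg_of_add_eq_zero_left hzero, inner_neg_left, real_inner_smul_left, hpn]
  ring

/-- The outward normal is `-∇ψ / |∇ψ|`, by the first order expansion of `ψ`, which is positive in
`Ω` and zero at `x`. -/
theorem mem_incoming_of_fderiv_pos (hψ : DifferentiableAt ℝ ψ x)
    (hloc : ∀ᶠ y in nhds x, (y ∈ Ω ↔ 0 < ψ y)) (h0 : ψ x = 0) (hx : x ∈ frontier Ω)
    (hone : 1 ≤ ‖fderiv ℝ ψ x‖) {v : Vec d} (hv : 0 < fderiv ℝ ψ x v) (t : ℝ) :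
    ((t, x, v) : Pt d) ∈ incoming Ω := by
  set p : Vec d := (InnerProductSpace.toDual ℝ (Vec d)).symm (fderiv ℝ ψ x) with hp
  have hpw : ∀ w, inner ℝ p w = fderiv ℝ ψ x w := fun w => by simp [hp]
  have hpn : ‖p‖ = ‖fderiv ℝ ψ x‖ := by simp [hp]
  have hp0 : 0 < ‖p‖ := by rw [hpn]; linarith
  have hp1 : ‖p‖⁻¹ ≤ 1 := inv_le_one_of_one_le₀ (by rw [hpn]; exact hone)
  refine ⟨hx, -(‖p‖⁻¹ • p), ⟨?_, fun ε hε => ?_⟩, ?_⟩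
  · rw [norm_neg, norm_smul, norm_inv, norm_norm, inv_mul_cancel₀ hp0.ne']
  · have h1 := hψ.hasFDerivAt.isLittleO.def hε
    filter_upwards [nhdsWithin_le_nhds h1, nhdsWithin_le_nhds hloc, self_mem_nhdsWithin]
      with y hy hy1 hyΩ
    have hpos := hy1.1 hyΩ
    rw [h0, Real.norm_eq_abs, sub_zero] at hy
    have h2 := (abs_le.1 hy).2
    rw [inner_neg_right, real_inner_smul_right, real_inner_comm, hpw]
    have h3 : -fderiv ℝ ψ x (y - x) ≤ ε * ‖y - x‖ := by linarith
    calc -(‖p‖⁻¹ * fderiv ℝ ψ x (y - x)) = ‖p‖⁻¹ * -fderiv ℝ ψ x (y - x) := by ring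
      _ ≤ ‖p‖⁻¹ * (ε * ‖y - x‖) := mul_le_mul_of_nonneg_left h3 (by positivity)
      _ ≤ ε * ‖y - x‖ := mul_le_of_le_one_left (by positivity) hp1
  · rw [inner_neg_left, real_inner_smul_left, hpw, neg_lt_zero]
    positivity

end LocalGeometry

/-! ### Symmetry under `f ↦ -f` and the Euclidean norm of a point. -/

theorem transport_neg {d : ℕ} (f : Pt d → ℝ) : transport (-f) = -transport f := by
  funext z
  simp [transport]

theorem gradV_neg {d : ℕ} (f : Pt d → ℝ) : gradV (-f) = -gradV f := by
  funext z
  refine ext_inner_right ℝ fun u => ?_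
  have : (fun w : Vec d => (-f) (z.1, z.2.1, w)) = -fun w : Vec d => f (z.1, z.2.1, w) := rfl
  rw [inner_gradV, this, fderiv_neg, Pi.neg_apply, inner_neg_left, inner_gradV]
  rfl

theorem hessV_neg {d : ℕ} (f : Pt d → ℝ) : hessV (-f) = -hessV f := by
  funext z
  ext i j
  simp only [hessV, Matrix.of_apply, Pi.neg_apply, Matrix.neg_apply]
  rw [show (fun w : Vec d => -f (z.1, z.2.1, w)) = -fun w : Vec d => f (z.1, z.2.1, w) from rfl,
    iteratedFDeriv_neg]
  rfl

theorem IsSolution.neg {d : ℕ} {Ω : Set (Vec d)} {A : Pt d → Matrix (Fin d) (Fin d) ℝ}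
    {B : Pt d → Vec d} {S f : Pt d → ℝ} {r : ℝ} {z₀ : Pt d} (h : IsSolution Ω A B S r z₀ f) :
    IsSolution Ω A B (-S) r z₀ (-f) where
  continuousOn := h.continuousOn.neg
  contDiffAt_v z hz := (h.contDiffAt_v z hz).neg
  continuousOn_hessV := by rw [hessV_neg]; exact h.continuousOn_hessV.neg
  differentiableAt_transport z hz := (h.differentiableAt_transport z hz).neg
  continuousOn_transport := by rw [transport_neg]; exact h.continuousOn_transport.neg
  equation z hz := by
    rw [transport_neg, hessV_neg, gradV_neg]
    simp only [Pi.neg_apply, Matrix.neg_apply, mul_neg, Finset.sum_neg_distrib, inner_neg_right]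
    rw [h.equation z hz]
    ring
  boundary z hz := by simp [h.boundary z hz]

theorem abs_fst_le_absPt {d : ℕ} (z : Pt d) : |z.1| ≤ absPt z :=
  Real.abs_le_sqrt (by nlinarith [sq_nonneg ‖z.2.1‖, sq_nonneg ‖z.2.2‖])

theorem norm_pos_le_absPt {d : ℕ} (z : Pt d) : ‖z.2.1‖ ≤ absPt z :=
  Real.le_sqrt_of_sq_le (by nlinarith [sq_nonneg z.1, sq_nonneg ‖z.2.2‖])

theorem norm_vel_le_absPt {d : ℕ} (z : Pt d) : ‖z.2.2‖ ≤ absPt z :=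
  Real.le_sqrt_of_sq_le (by nlinarith [sq_nonneg z.1, sq_nonneg ‖z.2.1‖])

/-! ### Strict supersolutions with explicit constants. -/

/-- The constant of the barrier for velocities of size at most `R + 1`. -/
noncomputable def barrierConst (d : ℕ) (Lam R : ℝ) : ℝ :=
  2 * (d * |Lam|) + 2 * |Lam| * (1 + (R + 1) ^ 2) + 4 * |Lam| + 2 * (R + 1) + 3

theorem IsDefining.norm_fderiv_le {d : ℕ} {Ω : Set (Vec d)} {r K b : ℝ} {x₀ : Vec d}
    {ψ : Vec d → ℝ} (h : IsDefining Ω r K x₀ ψ) (hK : 0 ≤ K) (hb : b ≤ 1) {x : Vec d}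
    (hx : ‖x - x₀‖ ≤ b) : ‖fderiv ℝ ψ x‖ ≤ 2 * K := by
  have h1 := norm_le_norm_add_norm_sub' (fderiv ℝ ψ x) (fderiv ℝ ψ x₀)
  have h2 := h.lipschitz x x₀
  have h3 : K * ‖x - x₀‖ ≤ K * 1 := mul_le_mul_of_nonneg_left (hx.trans hb) hK
  linarith [h.norm_le]

theorem IsDefining.le_mul_norm_sub {d : ℕ} {Ω : Set (Vec d)} {r K b : ℝ} {x₀ : Vec d}
    {ψ : Vec d → ℝ} (h : IsDefining Ω r K x₀ ψ) (hK : 0 ≤ K) (hb : b ≤ 1) {x y : Vec d}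
    (hx : ‖x - x₀‖ ≤ b) (hy : ‖y - x₀‖ ≤ b) (hψ : ψ y = 0) : ψ x ≤ 2 * K * ‖x - y‖ := by
  have := (convex_closedBall x₀ b).norm_image_sub_le_of_norm_fderiv_le (𝕜 := ℝ)
    (fun z _ => h.differentiable z)
    (fun z hz => h.norm_fderiv_le hK hb (by simpa [dist_eq_norm] using hz))
    (show y ∈ Metric.closedBall x₀ b by simpa [dist_eq_norm] using hy)
    (show x ∈ Metric.closedBall x₀ b by simpa [dist_eq_norm] using hx)
  rw [hψ, sub_zero] at this
  exact (le_abs_self _).trans this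

theorem IsDefining.eventually_mem_iff {d : ℕ} {Ω : Set (Vec d)} {r K : ℝ} {x₀ x : Vec d}
    {ψ : Vec d → ℝ} (h : IsDefining Ω r K x₀ ψ) (hx : ‖x - x₀‖ < r) :
    ∀ᶠ y in nhds x, (y ∈ Ω ↔ 0 < ψ y) := by
  filter_upwards [Metric.isOpen_ball.mem_nhds (show x ∈ Metric.ball x₀ r by
    simpa [dist_eq_norm] using hx)] with y hy using h.mem_iff y hy

/-- Near an incoming boundary point the defining function increases along the characteristics. -/
theorem IsDefining.le_fderiv {d : ℕ} {Ω : Set (Vec d)} {r K R b ν : ℝ} {x₀ v₀ n₀ x v : Vec d}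
    {ψ : Vec d → ℝ} (h : IsDefining Ω r K x₀ ψ) (hΩ : IsOpen Ω) (hr : 0 < r)
    (hx₀ : x₀ ∈ frontier Ω) (hK : 0 ≤ K) (hn : IsOuterUnitNormal Ω x₀ n₀)
    (hν : inner ℝ n₀ v₀ = -ν) (hν0 : 0 ≤ ν) (hR : ‖v₀‖ ≤ R) (hb1 : b ≤ 1)
    (hbK : K * b * (R + 2) ≤ ν / 2) (hx : ‖x - x₀‖ ≤ b) (hv : ‖v - v₀‖ ≤ b) :
    ν / 2 ≤ fderiv ℝ ψ x v := by
  have hloc := h.eventually_mem_iff (x := x₀) (by simpa using hr)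
  have h0 := eq_zero_of_mem_frontier hΩ (h.differentiable x₀).continuousAt hloc hx₀
  have h1 := fderiv_eq_of_isOuterUnitNormal (h.differentiable x₀) hloc h0 hn v₀
  rw [hν] at h1
  have h2 : ν ≤ fderiv ℝ ψ x₀ v₀ := by nlinarith [h.one_le_norm x₀]
  -- Moving `x` costs `K b R` and moving `v` costs `2 K b`; together this is `K b (R + 2) ≤ ν / 2`,
  -- half of the rate `ν` available at `(x₀, v₀)`.
  have e1 : fderiv ℝ ψ x v = fderiv ℝ ψ x₀ v₀ + (fderiv ℝ ψ x - fderiv ℝ ψ x₀) v₀ +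
      fderiv ℝ ψ x (v - v₀) := by
    rw [map_sub, sub_apply]; ring
  have h3 : |(fderiv ℝ ψ x - fderiv ℝ ψ x₀) v₀| ≤ K * b * R := by
    refine ((fderiv ℝ ψ x - fderiv ℝ ψ x₀).le_opNorm v₀).trans ?_
    have := (h.lipschitz x x₀).trans (mul_le_mul_of_nonneg_left hx hK)
    exact mul_le_mul this hR (norm_nonneg _) ((norm_nonneg _).trans this)
  have h4 : |fderiv ℝ ψ x (v - v₀)| ≤ 2 * K * b := by
    refine ((fderiv ℝ ψ x).le_opNorm _).trans ?_
    exact mul_le_mul (h.norm_fderiv_le hK hb1 hx) hv (norm_nonneg _) (by positivity)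
  have := (abs_le.1 h3).1
  have := (abs_le.1 h4).1
  linarith

theorem box_subset_cyl {d : ℕ} {Ω : Set (Vec d)} {b R t₀ : ℝ} {x₀ v₀ : Vec d} (hb : 0 ≤ b)
    (hb1 : b ≤ 1) (hbR : b * R ≤ 1) (hR : ‖v₀‖ ≤ R) :
    box Ω b (t₀, x₀, v₀) ⊆ cyl 2 (t₀, x₀, v₀) := by
  rintro ⟨t, x, v⟩ ⟨h1, h2, h3, h4, h5⟩
  dsimp only at h1 h2 h3 h4 h5
  refine ⟨?_, h2, ?_, ?_⟩ <;> dsimp only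
  · nlinarith
  · have e1 : ‖(t - t₀) • v₀‖ ≤ b ^ 2 * R := by
      rw [norm_smul, Real.norm_eq_abs]
      exact mul_le_mul (abs_le.2 ⟨by linarith, by nlinarith⟩) hR (norm_nonneg _) (by positivity)
    have e2 : b ^ 2 * R ≤ 1 := by nlinarith
    have e3 := norm_sub_le (x - x₀) ((t - t₀) • v₀)
    linarith
  · linarith

/-- Both signs of the comparison with the barrier, with the slope `κ` of the barrier made
explicit. -/
theorem abs_le_barrier {d : ℕ} {Ω : Set (Vec d)} (hΩ : IsOpen Ω)
    {lam Lam M N b t₀ r K R ν μ : ℝ}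
    {x₀ v₀ n₀ : Vec d} {A : Pt d → Matrix (Fin d) (Fin d) ℝ} {B : Pt d → Vec d} {S f : Pt d → ℝ}
    (hlam : 0 < lam) (hLam : 0 < Lam) (hell : Elliptic lam Lam A B (locDomInt Ω 2 (t₀, x₀, v₀)))
    (hsol : IsSolution Ω A B S 2 (t₀, x₀, v₀) f)
    (hS : ∀ᵐ z ∂(volume.restrict (locDomInt Ω 2 (t₀, x₀, v₀))), |S z| ≤ M)
    {ψ : Vec d → ℝ} (hψ : IsDefining Ω r K x₀ ψ) (hK : 0 ≤ K) (hx₀ : x₀ ∈ frontier Ω)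
    (hn : IsOuterUnitNormal Ω x₀ n₀) (hν : inner ℝ n₀ v₀ = -ν) (hν0 : 0 < ν)
    (hR : ‖v₀‖ ≤ R) (hb : 0 < b) (hb1 : b ≤ 1) (hbR : b * R ≤ 1) (hbr : b < r)
    (hbK : K * b * (R + 2) ≤ ν / 2) (hμ : 0 ≤ μ)
    (hfN : ∀ z ∈ box Ω b (t₀, x₀, v₀), |f z| ≤ N)
    {F F₁ F₂ : ℝ → ℝ} (hF : ∀ s, HasDerivAt F (F₁ s) s) (hF₁ : ∀ s, HasDerivAt F₁ (F₂ s) s)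
    (hF₁0 : ∀ s, 0 < F₁ s) (hF₁M : ∀ s, M ≤ F₁ s) (hF₂0 : ∀ s, 0 ≤ F₂ s)
    (hF₂μ : ∀ s, F₂ s ≤ μ * F₁ s) (hFzero : 0 ≤ F 0) (hFone : N ≤ F 1)
    {z : Pt d} (hz : z ∈ box Ω b (t₀, x₀, v₀)) :
    |f z| ≤ F (weight (b ^ 2)⁻¹ v₀
      (posWeight b (2 * barrierConst d Lam R * (1 + μ) / (b ^ 2 * ν)) t₀ x₀ ψ) z) := by
  set κ := 2 * barrierConst d Lam R * (1 + μ) / (b ^ 2 * ν) with hκ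
  have hR0 : 0 ≤ R := (norm_nonneg _).trans hR
  have hN0 : 0 < barrierConst d Lam R := by unfold barrierConst; positivity
  have hcyl : box Ω b (t₀, x₀, v₀) ⊆ cyl 2 (t₀, x₀, v₀) := box_subset_cyl hb.le hb1 hbR hR
  have hκ0 : 0 ≤ κ := by positivity
  have hloc : ∀ z ∈ box Ω b (t₀, x₀, v₀), ∀ᶠ y in nhds z.2.1, (y ∈ Ω ↔ 0 < ψ y) := fun z hz =>
    hψ.eventually_mem_iff (hz.2.2.1.trans_lt hbr)
  have hder : ∀ z ∈ box Ω b (t₀, x₀, v₀), ν / 2 ≤ fderiv ℝ ψ z.2.1 z.2.2 := fun z hz =>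
    hψ.le_fderiv hΩ (hb.trans hbr) hx₀ hK hn hν hν0.le hR hb1 hbK hz.2.2.1 hz.2.2.2.2
  have hψ0 : ∀ z ∈ box Ω b (t₀, x₀, v₀), 0 ≤ ψ z.2.1 := fun z hz =>
    nonneg_of_mem_closure (hψ.differentiable _).continuousAt (hloc z hz) hz.2.2.2.1
  have hin : ∀ z ∈ box Ω b (t₀, x₀, v₀), z.2.1 ∈ frontier Ω → z ∈ incoming Ω := fun z hz hx =>
    mem_incoming_of_fderiv_pos (hψ.differentiable _) (hloc z hz)
      (eq_zero_of_mem_frontier hΩ (hψ.differentiable _).continuousAt (hloc z hz) hx) hx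
      (hψ.one_le_norm _) ((half_pos hν0).trans_le (hder z hz)) z.1
  set β := (b ^ 2)⁻¹ with hβ
  have hβ0 : 0 < β := by positivity
  have hβb : β * b ^ 2 = 1 := inv_mul_cancel₀ (by positivity)
  have hβ1 : 1 ≤ β := (one_le_inv₀ (by positivity)).2 (by nlinarith)
  have hκν : κ * (ν / 2) = β * (barrierConst d Lam R * (1 + μ)) := by
    rw [hκ, hβ]; field_simp
  have hstrict : ∀ z ∈ box Ω b (t₀, x₀, v₀), ∀ F1 F2 : ℝ, 0 < F1 → M ≤ F1 → F2 ≤ μ * F1 →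
      F1 * (2 * β * (d * Lam) + Lam * (1 + ‖z.2.2‖ ^ 2) * (2 * β * ‖z.2.2 - v₀‖)) +
        F2 * (4 * β ^ 2 * (Lam * ‖z.2.2 - v₀‖ ^ 2)) + M
      < F1 * (β * (2 * inner ℝ (z.2.1 - x₀) z.2.2 - 1) + κ * fderiv ℝ ψ z.2.1 z.2.2) := by
    intro z hz F1 F2 h1 h2 h3
    have hv : ‖z.2.2 - v₀‖ ≤ b := hz.2.2.2.2
    have hx : ‖z.2.1 - x₀‖ ≤ b := hz.2.2.1
    have hvR : ‖z.2.2‖ ≤ R + 1 := by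
      have := norm_le_norm_add_norm_sub' z.2.2 v₀
      linarith
    have hv2 : ‖z.2.2 - v₀‖ ^ 2 ≤ b ^ 2 := pow_le_pow_left₀ (norm_nonneg _) hv 2
    have hvR2 : ‖z.2.2‖ ^ 2 ≤ (R + 1) ^ 2 := pow_le_pow_left₀ (norm_nonneg _) hvR 2
    have a1 : Lam * (1 + ‖z.2.2‖ ^ 2) * (2 * β * ‖z.2.2 - v₀‖) ≤
        Lam * (1 + (R + 1) ^ 2) * (2 * β * 1) := by
      gcongr
      exact hv.trans hb1
    -- The factor `b⁻⁴` from the squared gradient of the weight loses `b⁻²` to `|v - v₀|² ≤ b²`, so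
    -- all terms scale like `b⁻²`.
    have a2 : F2 * (4 * β ^ 2 * (Lam * ‖z.2.2 - v₀‖ ^ 2)) ≤ F1 * (β * (4 * Lam * μ)) := by
      calc F2 * (4 * β ^ 2 * (Lam * ‖z.2.2 - v₀‖ ^ 2))
          ≤ (μ * F1) * (4 * β ^ 2 * (Lam * b ^ 2)) := by gcongr
        _ = F1 * (4 * β * (β * b ^ 2) * Lam * μ) := by ring
        _ = F1 * (β * (4 * Lam * μ)) := by rw [hβb]; ring
    have a3 : -(R + 1) ≤ inner ℝ (z.2.1 - x₀) z.2.2 := by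
      have h4 := (abs_le.1 (abs_real_inner_le_norm (z.2.1 - x₀) z.2.2)).1
      have h5 : ‖z.2.1 - x₀‖ * ‖z.2.2‖ ≤ 1 * (R + 1) :=
        mul_le_mul (hx.trans hb1) hvR (norm_nonneg _) zero_le_one
      linarith
    have a4 : β * (barrierConst d Lam R * (1 + μ)) ≤ κ * fderiv ℝ ψ z.2.1 z.2.2 := by
      rw [← hκν]
      exact mul_le_mul_of_nonneg_left (hder z hz) hκ0
    -- The terms come from the trace, the drift, the convexity of `F` and the transport of `|x -
    -- x₀|²`. Of the final 2, one unit is for the transport of `t₀ - t` and one for the source, as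
    -- `M ≤ F₁` and `β ≥ 1`; the third unit in `barrierConst` gives strictness.
    have a5 : β * (2 * (d * Lam) + 2 * Lam * (1 + (R + 1) ^ 2) + 4 * Lam * μ + 2 * (R + 1) + 2) <
        β * (barrierConst d Lam R * (1 + μ)) := by
      refine mul_lt_mul_of_pos_left ?_ hβ0
      unfold barrierConst
      rw [abs_of_pos hLam]
      have : 0 ≤ (2 * (d * Lam) + 2 * Lam * (1 + (R + 1) ^ 2) + 2 * (R + 1) + 3) * μ := by
        positivity
      linarith
    have a6 : 2 * β * (d * Lam) + Lam * (1 + ‖z.2.2‖ ^ 2) * (2 * β * ‖z.2.2 - v₀‖) +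
        β * (4 * Lam * μ) + 1 <
        β * (2 * inner ℝ (z.2.1 - x₀) z.2.2 - 1) + κ * fderiv ℝ ψ z.2.1 z.2.2 := by
      have : β * (2 * -(R + 1) - 1) ≤ β * (2 * inner ℝ (z.2.1 - x₀) z.2.2 - 1) := by gcongr
      linarith
    have a7 := mul_lt_mul_of_pos_left a6 h1
    linarith
  have hS1 : ∀ᵐ z ∂(volume.restrict (locDomInt Ω 2 (t₀, x₀, v₀))), S z ≤ M :=
    hS.mono fun z h => (abs_le.1 h).2
  have hS2 : ∀ᵐ z ∂(volume.restrict (locDomInt Ω 2 (t₀, x₀, v₀))), (-S) z ≤ M :=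
    hS.mono fun z h => by rw [Pi.neg_apply]; linarith [(abs_le.1 h).1]
  refine abs_le'.2 ⟨?_, ?_⟩
  · exact le_barrier hΩ hlam hell hsol hS1 hb hcyl hψ.differentiable hκ0 hψ0 hin
      (fun z hz => (abs_le.1 (hfN z hz)).2) hF hF₁ (fun s => (hF₁0 s).le) hF₂0 hFzero hFone
      (fun z hz => hstrict z hz _ _ (hF₁0 _) (hF₁M _) (hF₂μ _)) hz
  · exact le_barrier hΩ hlam hell hsol.neg hS2 hb hcyl hψ.differentiable hκ0 hψ0 hin
      (fun z hz => by rw [Pi.neg_apply]; linarith [(abs_le.1 (hfN z hz)).1])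
      hF hF₁ (fun s => (hF₁0 s).le) hF₂0 hFzero hFone
      (fun z hz => hstrict z hz _ _ (hF₁0 _) (hF₁M _) (hF₂μ _)) hz

/-! ### The two boundary estimates. -/

/-- The ratio between the size of the box and `|v₀ · n₀|`. -/
noncomputable def boxRatio (r K R : ℝ) : ℝ :=
  min (r / (2 * R)) (1 / (2 * K * (R + 2) * R ^ 2))

/-- The constant of the boundary estimates. -/
noncomputable def estimateConst (d : ℕ) (Lam r K R : ℝ) : ℝ :=
  (3 * R + 32 * K * barrierConst d Lam R) / boxRatio r K R ^ 2

theorem boxRatio_pos {r K R : ℝ} (hr : 0 < r) (hK : 1 ≤ K) (hR : 1 ≤ R) :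
    0 < boxRatio r K R :=
  lt_min (by positivity) (by positivity)

theorem boxRatio_le_one {r K R : ℝ} (hK : 1 ≤ K) (hR : 1 ≤ R) : boxRatio r K R ≤ 1 := by
  refine (min_le_right _ _).trans ((div_le_one (by positivity)).2 ?_)
  nlinarith [one_le_pow₀ (n := 2) hR, one_le_mul_of_one_le_of_one_le hK hR]

/-- The first term of the minimum keeps the box inside the ball of `ψ`, since `ν ≤ R`. The second
keeps `v · ∇ψ` above `ν / 2`, and its factor `R²` gives `b R ≤ 1`, which confines the drift of the
kinetic cylinder. -/
theorem boxRatio_spec {r K R ν : ℝ} (hr : 0 < r) (hK : 1 ≤ K) (hR : 1 ≤ R) (hν0 : 0 < ν)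
    (hνR : ν ≤ R) {b : ℝ} (hb : b = boxRatio r K R * ν) :
    0 < b ∧ b ≤ 1 ∧ b * R ≤ 1 ∧ b < r ∧ K * b * (R + 2) ≤ ν / 2 := by
  have hc0 := boxRatio_pos hr hK hR
  have hc1 : boxRatio r K R * (2 * R) ≤ r := (le_div_iff₀ (by positivity)).1 (min_le_left _ _)
  have hc2 : boxRatio r K R * (2 * K * (R + 2) * R ^ 2) ≤ 1 :=
    (le_div_iff₀ (by positivity)).1 (min_le_right _ _)
  set c := boxRatio r K R
  have hb0 : 0 < b := by rw [hb]; positivity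
  have hcR2 : c * R ^ 2 ≤ 1 := by
    refine le_trans ?_ hc2
    have : (1 : ℝ) ≤ 2 * K * (R + 2) := by nlinarith
    calc c * R ^ 2 = 1 * (c * R ^ 2) := by ring
      _ ≤ (2 * K * (R + 2)) * (c * R ^ 2) := by gcongr
      _ = _ := by ring
  have hbcR : b ≤ c * R := hb ▸ mul_le_mul_of_nonneg_left hνR hc0.le
  have hbR : b * R ≤ 1 := by
    calc b * R ≤ c * R * R := by gcongr
      _ = c * R ^ 2 := by ring
      _ ≤ 1 := hcR2
  refine ⟨hb0, by nlinarith, hbR, ?_, ?_⟩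
  · nlinarith [mul_pos hc0 (by linarith : (0 : ℝ) < R)]
  · have h1 : c * (2 * K * (R + 2)) ≤ 1 := by
      refine le_trans ?_ hc2
      have : (1 : ℝ) ≤ R ^ 2 := one_le_pow₀ hR
      calc c * (2 * K * (R + 2)) = c * (2 * K * (R + 2)) * 1 := by ring
        _ ≤ c * (2 * K * (R + 2)) * R ^ 2 := by gcongr
        _ = _ := by ring
    have h2 : K * b * (R + 2) = c * (2 * K * (R + 2)) * ν / 2 := by rw [hb]; ring
    have h3 := mul_le_mul_of_nonneg_right h1 hν0.le
    linarith

theorem barrierConst_pos {d : ℕ} {Lam R : ℝ} (hR : 1 ≤ R) : 3 < barrierConst d Lam R := by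
  unfold barrierConst
  have : 0 < 2 * (d * |Lam|) + 2 * |Lam| * (1 + (R + 1) ^ 2) + 4 * |Lam| + 2 * (R + 1) := by
    positivity
  linarith

theorem estimateConst_mul_sq {d : ℕ} {Lam r K R : ℝ} (hr : 0 < r) (hK : 1 ≤ K) (hR : 1 ≤ R) :
    estimateConst d Lam r K R * boxRatio r K R ^ 2 = 3 * R + 32 * K * barrierConst d Lam R :=
  div_mul_cancel₀ _ (pow_pos (boxRatio_pos hr hK hR) 2).ne'

theorem estimateConst_pos {d : ℕ} {Lam r K R : ℝ} (hr : 0 < r) (hK : 1 ≤ K) (hR : 1 ≤ R) :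
    0 < estimateConst d Lam r K R := by
  have := boxRatio_pos hr hK hR
  have := barrierConst_pos (d := d) (Lam := Lam) hR
  unfold estimateConst
  positivity

theorem cyl_mono {d : ℕ} {r r' : ℝ} (hr : 0 ≤ r) (h : r ≤ r') (z₀ : Pt d) :
    cyl r z₀ ⊆ cyl r' z₀ := fun z hz =>
  ⟨by have := pow_le_pow_left₀ hr h 2; linarith [hz.1], hz.2.1,
    hz.2.2.1.trans_le (pow_le_pow_left₀ hr h 3), hz.2.2.2.trans_le h⟩

theorem enorm_le_supNorm {d : ℕ} {f : Pt d → ℝ} {G : Set (Pt d)} {z : Pt d} (hz : z ∈ G) :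
    ‖f z‖ₑ ≤ supNorm f G :=
  le_iSup₂ (f := fun z (_ : z ∈ G) => ‖f z‖ₑ) z hz

theorem abs_le_toReal_supNorm {d : ℕ} {f : Pt d → ℝ} {G : Set (Pt d)} (hfin : supNorm f G ≠ ⊤)
    {z : Pt d} (hz : z ∈ G) : |f z| ≤ (supNorm f G).toReal := by
  have := ENNReal.toReal_mono hfin (enorm_le_supNorm hz)
  simpa using this

theorem ae_abs_le_toReal_essNorm {d : ℕ} {S : Pt d → ℝ} {G U : Set (Pt d)} (hUG : U ⊆ G)
    (hS : MemLp S ⊤ (volume.restrict G)) :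
    ∀ᵐ z ∂(volume.restrict U), |S z| ≤ (essNorm S G).toReal := by
  have h1 : ∀ᵐ z ∂(volume.restrict G), ‖S z‖ₑ ≤ essNorm S G := by
    rw [essNorm, eLpNorm_exponent_top]
    exact ae_le_eLpNormEssSup
  filter_upwards [ae_mono (Measure.restrict_mono hUG le_rfl) h1] with z hz
  have := ENNReal.toReal_mono (b := essNorm S G) hS.eLpNorm_ne_top hz
  simpa only [toReal_enorm, Real.norm_eq_abs] using this

/-- The box has duration `b²` and size `b ≥ b²` in the other variables, so leaving it requires a
distance of at least `b²`. -/
theorem sq_le_absPt_sub_of_notMem_box {d : ℕ} {Ω : Set (Vec d)} {b : ℝ} (hb : 0 ≤ b) (hb1 : b ≤ 1)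
    {z z₀ : Pt d} (ht : z.1 ≤ z₀.1) (hx : z.2.1 ∈ closure Ω) (hz : z ∉ box Ω b z₀) :
    b ^ 2 ≤ absPt (z - z₀) := by
  by_contra! h
  have h1 := abs_fst_le_absPt (z - z₀)
  have h2 := norm_pos_le_absPt (z - z₀)
  have h3 := norm_vel_le_absPt (z - z₀)
  have hbb : b ^ 2 ≤ b := by nlinarith
  simp only [Prod.fst_sub, Prod.snd_sub] at h1 h2 h3
  exact hz ⟨by linarith [(abs_le.1 h1).1], ht, by linarith, hx, by linarith⟩

theorem le_of_inner_eq_neg {d : ℕ} {n v : Vec d} {R ν : ℝ} (hn : ‖n‖ = 1)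
    (hν : inner ℝ n v = -ν) (hR : ‖v‖ ≤ R) : ν ≤ R := by
  have h1 := (abs_le.1 (abs_real_inner_le_norm n v)).1
  rw [hν, hn] at h1
  linarith

/-- The gradient estimate at an incoming boundary point, with an explicit constant. -/
theorem gradient_estimate {d : ℕ} {Ω : Set (Vec d)} (hΩ : IsOpen Ω)
    {lam Lam t₀ r K R ν : ℝ} {x₀ v₀ n₀ : Vec d} {A : Pt d → Matrix (Fin d) (Fin d) ℝ}
    {B : Pt d → Vec d} {S f : Pt d → ℝ} {ψ : Vec d → ℝ}
    (hψ : IsDefining Ω r K x₀ ψ) (hr : 0 < r) (hK : 1 ≤ K) (hR1 : 1 ≤ R) (hR : ‖v₀‖ ≤ R)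
    (hx₀ : x₀ ∈ frontier Ω) (hn : IsOuterUnitNormal Ω x₀ n₀) (hν : inner ℝ n₀ v₀ = -ν)
    (hν0 : 0 < ν) (hlam : 0 < lam) (hLam : 0 < Lam)
    (hell : Elliptic lam Lam A B (locDomInt Ω 2 (t₀, x₀, v₀)))
    (hsol : IsSolution Ω A B S 2 (t₀, x₀, v₀) f) {M₀ : ℝ} (hM₀0 : 0 ≤ M₀)
    (hM₀ : ∀ z ∈ locDom Ω 2 (t₀, x₀, v₀), |f z| ≤ M₀)
    {M₁ : ℝ} (hM₁ : 0 ≤ M₁)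
    (hS : ∀ᵐ z ∂(volume.restrict (locDomInt Ω 2 (t₀, x₀, v₀))), |S z| ≤ M₁)
    {z : Pt d} (hz : z ∈ locDom Ω 1 (t₀, x₀, v₀)) :
    |f z| ≤ estimateConst d Lam r K R * absPt (z - (t₀, x₀, v₀)) / ν ^ 3 * (M₀ + M₁) := by
  have hc0 := boxRatio_pos hr hK hR1
  have hN := barrierConst_pos (d := d) (Lam := Lam) hR1
  have hCc := estimateConst_mul_sq (d := d) (Lam := Lam) hr hK hR1
  have hC0 := estimateConst_pos (d := d) (Lam := Lam) hr hK hR1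
  have hνR := le_of_inner_eq_neg hn.1 hν hR
  obtain ⟨hb, hb1, hbR, hbr, hbK⟩ := boxRatio_spec hr hK hR1 hν0 hνR rfl
  generalize hCdef : estimateConst d Lam r K R = C at *
  generalize hNdef : barrierConst d Lam R = Nb at *
  generalize hcdef : boxRatio r K R = c at *
  generalize hbdef : c * ν = b at *
  have hK0 : 0 ≤ K := by linarith
  have hcyl : box Ω b (t₀, x₀, v₀) ⊆ locDom Ω 2 (t₀, x₀, v₀) := fun z hz =>
    ⟨box_subset_cyl hb.le hb1 hbR hR hz, hz.2.2.2.1⟩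
  have h12 : locDom Ω 1 (t₀, x₀, v₀) ⊆ locDom Ω 2 (t₀, x₀, v₀) := fun z hz =>
    ⟨cyl_mono zero_le_one one_le_two _ hz.1, hz.2⟩
  have hfN : ∀ z ∈ box Ω b (t₀, x₀, v₀), |f z| ≤ M₀ := fun z hz => hM₀ z (hcyl hz)
  have hψfr : ∀ x, ‖x - x₀‖ ≤ b → x ∈ frontier Ω → ψ x = 0 := fun x hx hxf =>
    eq_zero_of_mem_frontier hΩ (hψ.differentiable x).continuousAt
      (hψ.eventually_mem_iff (hx.trans_lt hbr)) hxf
  have hψx₀ : ψ x₀ = 0 := hψfr x₀ (by simpa using hb.le) hx₀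
  set a := absPt (z - (t₀, x₀, v₀)) with ha
  have ha0 : 0 ≤ a := Real.sqrt_nonneg _
  -- The barrier needs a positive slope; if `M₀ + M₁ = 0`, then `f` vanishes.
  rcases (add_nonneg hM₀0 hM₁).eq_or_lt' with hM | hM
  · rw [hM, mul_zero]
    linarith [hM₀ z (h12 hz)]
  by_cases hzb : z ∈ box Ω b (t₀, x₀, v₀)
  -- Linear barrier of slope `M₀ + M₁`, which dominates both the source and, at `s = 1`, the values
  -- of `f`.
  · have hmain := abs_le_barrier hΩ hlam hLam hell hsol hS hψ hK0 hx₀ hn hν hν0 hR hb hb1 hbR hbr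
      hbK le_rfl hfN (F := fun s => (M₀ + M₁) * s) (F₁ := fun _ => M₀ + M₁) (F₂ := fun _ => 0)
      (fun s => by simpa using (hasDerivAt_id s).const_mul (M₀ + M₁))
      (fun s => hasDerivAt_const s _) (fun _ => hM) (fun _ => by linarith) (fun _ => le_rfl)
      (fun _ => by simp) (by simp) (by linarith) hzb
    rw [hNdef] at hmain
    refine hmain.trans ?_
    rw [mul_comm]
    refine mul_le_mul_of_nonneg_right ?_ hM.le
    have h1 : t₀ - z.1 ≤ a := by
      have := (abs_le.1 (abs_fst_le_absPt (z - (t₀, x₀, v₀)))).1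
      simp only [Prod.fst_sub] at this
      linarith
    have h2 : ‖z.2.1 - x₀‖ ≤ a := norm_pos_le_absPt (z - (t₀, x₀, v₀))
    have h3 : ‖z.2.2 - v₀‖ ≤ a := norm_vel_le_absPt (z - (t₀, x₀, v₀))
    have h2b : ‖z.2.1 - x₀‖ ≤ b := hzb.2.2.1
    have h3b : ‖z.2.2 - v₀‖ ≤ b := hzb.2.2.2.2
    have h2' : ‖z.2.1 - x₀‖ ^ 2 ≤ a := by nlinarith [norm_nonneg (z.2.1 - x₀)]
    have h3' : ‖z.2.2 - v₀‖ ^ 2 ≤ a := by nlinarith [norm_nonneg (z.2.2 - v₀)]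
    have h4 : ψ z.2.1 ≤ 2 * K * a :=
      (hψ.le_mul_norm_sub hK0 hb1 h2b (by simpa using hb.le) hψx₀).trans (by gcongr)
    calc weight (b ^ 2)⁻¹ v₀ (posWeight b (2 * Nb * (1 + 0) / (b ^ 2 * ν)) t₀ x₀ ψ) z
        = (b ^ 2)⁻¹ * (‖z.2.2 - v₀‖ ^ 2 + ‖z.2.1 - x₀‖ ^ 2 + (t₀ - z.1)) +
          2 * Nb / (b ^ 2 * ν) * ψ z.2.1 := by
          simp only [weight, posWeight, add_zero, mul_one]; ring
      _ ≤ (b ^ 2)⁻¹ * (a + a + a) + 2 * Nb / (b ^ 2 * ν) * (2 * K * a) := by gcongr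
      _ = (3 * ν + 4 * K * Nb) / c ^ 2 * (a / ν ^ 3) := by
          rw [← hbdef]; field_simp; ring
      _ ≤ C * (a / ν ^ 3) := by
          refine mul_le_mul_of_nonneg_right ?_ (by positivity)
          rw [div_le_iff₀ (by positivity), hCc]
          have : 0 ≤ K * Nb := by positivity
          linarith
      _ = C * a / ν ^ 3 := by ring
  -- Outside the box `|z - z₀| ≥ b² = c² ν²`, so the claimed bound already exceeds `M₀`.
  · have h1 : b ^ 2 ≤ a := sq_le_absPt_sub_of_notMem_box hb.le hb1 hz.1.2.1 hz.2 hzb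
    have h2 : 1 ≤ C * a / ν ^ 3 := by
      rw [one_le_div (by positivity)]
      have h3 : C * b ^ 2 ≤ C * a := by gcongr
      have h4 : C * b ^ 2 = (3 * R + 32 * K * Nb) * ν ^ 2 := by rw [← hCc, ← hbdef]; ring
      have h5 : ν ^ 3 ≤ (3 * R + 32 * K * Nb) * ν ^ 2 := by
        rw [show ν ^ 3 = ν * ν ^ 2 by ring]
        have : 0 ≤ K * Nb := by positivity
        gcongr
        linarith
      linarith
    calc |f z| ≤ M₀ := hM₀ z (h12 hz)
      _ ≤ 1 * (M₀ + M₁) := by linarith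
      _ ≤ _ := mul_le_mul_of_nonneg_right h2 hM.le

/-- The infinite-order vanishing at an incoming boundary point, with an explicit constant. -/
theorem infinite_order_vanishing {d : ℕ} {Ω : Set (Vec d)} (hΩ : IsOpen Ω)
    {lam Lam t₀ r K R ν : ℝ} {x₀ v₀ n₀ : Vec d} {A : Pt d → Matrix (Fin d) (Fin d) ℝ}
    {B : Pt d → Vec d} {S f : Pt d → ℝ} {ψ : Vec d → ℝ}
    (hψ : IsDefining Ω r K x₀ ψ) (hr : 0 < r) (hK : 1 ≤ K) (hR1 : 1 ≤ R) (hR : ‖v₀‖ ≤ R)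
    (hx₀ : x₀ ∈ frontier Ω) (hn : IsOuterUnitNormal Ω x₀ n₀) (hν : inner ℝ n₀ v₀ = -ν)
    (hν0 : 0 < ν) (hlam : 0 < lam) (hLam : 0 < Lam)
    (hell : Elliptic lam Lam A B (locDomInt Ω 2 (t₀, x₀, v₀)))
    (hsol : IsSolution Ω A B S 2 (t₀, x₀, v₀) f) {M₀ : ℝ} (hM₀0 : 0 ≤ M₀)
    (hM₀ : ∀ z ∈ locDom Ω 2 (t₀, x₀, v₀), |f z| ≤ M₀)
    (hS : ∀ z ∈ locDomInt Ω 2 (t₀, x₀, v₀), S z = 0)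
    {x : Vec d} (hx : (t₀, x, v₀) ∈ locDom Ω 1 (t₀, x₀, v₀))
    (hxC : ‖x - x₀‖ ≤ ν / estimateConst d Lam r K R) (hδ : 0 < Metric.infDist x (frontier Ω)) :
    |f (t₀, x, v₀)| ≤ M₀ * Real.exp (1 - ν ^ 3 /
      (estimateConst d Lam r K R * Metric.infDist x (frontier Ω))) := by
  have hc0 := boxRatio_pos hr hK hR1
  have hN := barrierConst_pos (d := d) (Lam := Lam) hR1
  have hCc := estimateConst_mul_sq (d := d) (Lam := Lam) hr hK hR1
  have hC0 := estimateConst_pos (d := d) (Lam := Lam) hr hK hR1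
  have hνR := le_of_inner_eq_neg hn.1 hν hR
  obtain ⟨hb, hb1, hbR, hbr, hbK⟩ := boxRatio_spec hr hK hR1 hν0 hνR rfl
  generalize hCdef : estimateConst d Lam r K R = C at *
  generalize hNdef : barrierConst d Lam R = Nb at *
  generalize hcdef : boxRatio r K R = c at *
  generalize hbdef : c * ν = b at *
  have hK0 : 0 ≤ K := by linarith
  have hcyl : box Ω b (t₀, x₀, v₀) ⊆ locDom Ω 2 (t₀, x₀, v₀) := fun z hz =>
    ⟨box_subset_cyl hb.le hb1 hbR hR hz, hz.2.2.2.1⟩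
  have h12 : locDom Ω 1 (t₀, x₀, v₀) ⊆ locDom Ω 2 (t₀, x₀, v₀) := fun z hz =>
    ⟨cyl_mono zero_le_one one_le_two _ hz.1, hz.2⟩
  have hfN : ∀ z ∈ box Ω b (t₀, x₀, v₀), |f z| ≤ M₀ := fun z hz => hM₀ z (hcyl hz)
  have hψfr : ∀ x, ‖x - x₀‖ ≤ b → x ∈ frontier Ω → ψ x = 0 := fun x hx hxf =>
    eq_zero_of_mem_frontier hΩ (hψ.differentiable x).continuousAt
      (hψ.eventually_mem_iff (hx.trans_lt hbr)) hxf
  set δ := Metric.infDist x (frontier Ω) with hδdef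
  rcases hM₀0.eq_or_lt' with hM | hM
  · rw [hM, zero_mul, ← hM]
    exact hM₀ _ (h12 hx)
  have hKN : 0 < K * Nb := by positivity
  -- If `δ` is not small compared with `ν³`, the exponent is nonnegative and the bound is trivial;
  -- otherwise the `μ` chosen below is positive.
  rcases le_or_gt (c ^ 2 * ν ^ 3) (16 * K * Nb * δ) with hcase | hcase
  · refine (hM₀ _ (h12 hx)).trans (le_mul_of_one_le_right hM.le (Real.one_le_exp ?_))
    rw [sub_nonneg, div_le_one (by positivity)]
    have h1 : c ^ 2 * ν ^ 3 ≤ c ^ 2 * (C * δ) := by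
      rw [show c ^ 2 * (C * δ) = C * c ^ 2 * δ by ring, hCc]
      have : 0 ≤ (3 * R + 16 * K * Nb) * δ := by positivity
      linarith
    exact le_of_mul_le_mul_left h1 (by positivity)
  -- This `μ` is the one for which `κ · 2 K δ = 1/4`. Together with `|x - x₀| ≤ b / 2`, worth
  -- another `1/4`, it gives `w ≤ 1/2`.
  · set μ := c ^ 2 * ν ^ 3 / (16 * K * Nb * δ) - 1 with hμ
    have hμ0 : 0 < μ := by
      rw [hμ, sub_pos, one_lt_div (by positivity)]
      exact hcase
    have hc1 : c ≤ 1 := hcdef ▸ boxRatio_le_one hK hR1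
    have hxb : ‖x - x₀‖ ≤ b / 2 := by
      refine hxC.trans ?_
      rw [div_le_iff₀ hC0, ← hbdef]
      have : 2 ≤ c * C := by
        have : c * (c * C) ≤ 1 * (c * C) := mul_le_mul_of_nonneg_right hc1 (by positivity)
        nlinarith
      nlinarith
    have hxb' : ‖x - x₀‖ ≤ b := by linarith
    have hbox : (t₀, x, v₀) ∈ box Ω b (t₀, x₀, v₀) :=
      ⟨by simp; positivity, le_rfl, hxb', hx.2, by simpa using hb.le⟩
    have hmain := abs_le_barrier (M := 0) (N := M₀) (μ := μ) hΩ hlam hLam hell hsol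
      (by
        refine (ae_restrict_mem (isOpen_locDomInt hΩ 2 (t₀, x₀, v₀)).measurableSet).mono ?_
        intro z hz
        simp [hS z hz])
      hψ hK0 hx₀ hn hν hν0 hR hb hb1 hbR hbr hbK hμ0.le hfN
      (F := fun s => M₀ * Real.exp (μ * (s - 1)))
      (F₁ := fun s => μ * (M₀ * Real.exp (μ * (s - 1))))
      (F₂ := fun s => μ * (μ * (M₀ * Real.exp (μ * (s - 1)))))
      (fun s => by
        have h1 : HasDerivAt (fun s : ℝ => μ * (s - 1)) μ s := by
          simpa using ((hasDerivAt_id s).sub_const 1).const_mul μ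
        exact (h1.exp.const_mul M₀).congr_deriv (by ring))
      (fun s => by
        have h1 : HasDerivAt (fun s : ℝ => μ * (s - 1)) μ s := by
          simpa using ((hasDerivAt_id s).sub_const 1).const_mul μ
        exact ((h1.exp.const_mul M₀).const_mul μ).congr_deriv (by ring))
      (fun s => by positivity) (fun s => by positivity) (fun s => by positivity)
      (fun s => le_rfl) (by positivity) (by simp) hbox
    rw [hNdef] at hmain
    refine hmain.trans (mul_le_mul_of_nonneg_left (Real.exp_le_exp.2 ?_) hM.le)
    -- The nearest boundary point lies within `2 |x - x₀| ≤ b` of `x₀`, so `ψ` vanishes there and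
    -- the mean value bound gives `ψ(x) ≤ 2 K δ`.
    obtain ⟨y, hy, hxy⟩ := isClosed_frontier.exists_infDist_eq_dist ⟨x₀, hx₀⟩ x
    have hyx : ‖x - y‖ = δ := by rw [hδdef, hxy, dist_eq_norm]
    have hδx : δ ≤ ‖x - x₀‖ := by
      rw [← dist_eq_norm]; exact Metric.infDist_le_dist_of_mem hx₀
    have hyb : ‖y - x₀‖ ≤ b := by
      have := norm_sub_le (x - x₀) (x - y)
      rw [sub_sub_sub_cancel_left] at this
      linarith
    have hψx : ψ x ≤ 2 * K * δ := by
      rw [← hyx]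
      exact hψ.le_mul_norm_sub hK0 hb1 hxb' hyb (hψfr y hyb hy)
    have hw : weight (b ^ 2)⁻¹ v₀ (posWeight b (2 * Nb * (1 + μ) / (b ^ 2 * ν)) t₀ x₀ ψ)
        (t₀, x, v₀) ≤ 1 / 2 := by
      calc weight (b ^ 2)⁻¹ v₀ (posWeight b (2 * Nb * (1 + μ) / (b ^ 2 * ν)) t₀ x₀ ψ)
            (t₀, x, v₀)
          = (b ^ 2)⁻¹ * ‖x - x₀‖ ^ 2 + 2 * Nb * (1 + μ) / (b ^ 2 * ν) * ψ x := by
            simp [weight, posWeight]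
        _ ≤ (b ^ 2)⁻¹ * (b / 2) ^ 2 + 2 * Nb * (1 + μ) / (b ^ 2 * ν) * (2 * K * δ) := by
            gcongr
        _ = 1 / 2 := by
            rw [hμ, ← hbdef]; field_simp; ring
    have h1 : μ * (weight (b ^ 2)⁻¹ v₀
        (posWeight b (2 * Nb * (1 + μ) / (b ^ 2 * ν)) t₀ x₀ ψ) (t₀, x, v₀) - 1) ≤
        μ * (1 / 2 - 1) := by gcongr
    refine h1.trans ?_
    -- The barrier yields the exponent `-μ / 2`; this halving turns 16 into the 32 of
    -- `estimateConst`, and the `-1` in `μ` becomes `+1/2`, below the allowed `1`.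
    have h2 : ν ^ 3 / (C * δ) ≤ c ^ 2 * ν ^ 3 / (32 * K * Nb * δ) := by
      rw [div_le_div_iff₀ (by positivity) (by positivity)]
      have : 32 * K * Nb ≤ C * c ^ 2 := by rw [hCc]; linarith
      calc ν ^ 3 * (32 * K * Nb * δ) ≤ ν ^ 3 * (C * c ^ 2 * δ) := by gcongr
        _ = _ := by ring
    have h3 : c ^ 2 * ν ^ 3 / (16 * K * Nb * δ) = 2 * (c ^ 2 * ν ^ 3 / (32 * K * Nb * δ)) := by
      field_simp; ring
    rw [hμ, h3]
    linarith

end KFP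

/-! ### The theorem, with norms that may be infinite. -/

theorem theorem1p2 (d : ℕ) (Ω : Set (KFP.Vec d)) (hΩo : IsOpen Ω) (hΩc : IsConnected Ω)
    (hΩb : Bornology.IsBounded Ω) (hΩ : KFP.HasC11Boundary Ω) (Lam : ℝ) :
    ∃ Cstar : ℝ → ℝ, (∀ ρ, 0 < Cstar ρ) ∧
      ∀ (t₀ : ℝ) (x₀ v₀ n₀ : KFP.Vec d), x₀ ∈ frontier Ω →
        KFP.IsOuterUnitNormal Ω x₀ n₀ → inner ℝ n₀ v₀ < 0 →
      ∀ lam : ℝ, 0 < lam → lam < Lam →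
      ∀ (A : KFP.Pt d → Matrix (Fin d) (Fin d) ℝ) (B : KFP.Pt d → KFP.Vec d)
        (S f : KFP.Pt d → ℝ),
        KFP.Elliptic lam Lam A B (KFP.locDomInt Ω 2 (t₀, x₀, v₀)) →
        MemLp S ⊤ (volume.restrict (KFP.locDom Ω 2 (t₀, x₀, v₀))) →
        KFP.IsSolution Ω A B S 2 (t₀, x₀, v₀) f →
        (∀ z ∈ KFP.locDom Ω 1 (t₀, x₀, v₀),
          ‖f z‖ₑ ≤
            ENNReal.ofReal (Cstar (KFP.absPt (t₀, x₀, v₀)) * KFP.absPt (z - (t₀, x₀, v₀)) /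
                |inner ℝ v₀ n₀| ^ 3) *
              (KFP.supNorm f (KFP.locDom Ω 2 (t₀, x₀, v₀)) +
                KFP.essNorm S (KFP.locDom Ω 2 (t₀, x₀, v₀)))) ∧
        ((∀ z ∈ KFP.locDomInt Ω 2 (t₀, x₀, v₀), S z = 0) →
          ∀ x : KFP.Vec d, (t₀, x, v₀) ∈ KFP.locDom Ω 1 (t₀, x₀, v₀) →
            ‖x - x₀‖ ≤ |inner ℝ v₀ n₀| / Cstar (KFP.absPt (t₀, x₀, v₀)) →
            0 < Metric.infDist x (frontier Ω) →
            Metric.infDist x (frontier Ω) ≤ |inner ℝ v₀ n₀| ^ 3 →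
            ‖f (t₀, x, v₀)‖ₑ ≤
              KFP.supNorm f (KFP.locDom Ω 2 (t₀, x₀, v₀)) *
                ENNReal.ofReal (Real.exp (1 - |inner ℝ n₀ v₀| ^ 3 /
                  (Cstar (KFP.absPt (t₀, x₀, v₀)) * Metric.infDist x (frontier Ω))))) := by
  obtain ⟨r, hr, K, hdef⟩ := KFP.exists_uniform_isDefining hΩb hΩ
  have hR1 : ∀ ρ : ℝ, 1 ≤ |ρ| + 1 := fun ρ => by linarith [abs_nonneg ρ]
  refine ⟨fun ρ => KFP.estimateConst d Lam r (max K 1) (|ρ| + 1),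
    fun ρ => KFP.estimateConst_pos hr (le_max_right _ _) (hR1 ρ), ?_⟩
  intro t₀ x₀ v₀ n₀ hx₀ hn hneg lam hlam hlamLam A B S f hell hS hsol
  obtain ⟨ψ, hψ⟩ := hdef x₀ hx₀
  have hψ' := hψ.mono le_rfl (le_max_left K 1)
  set ρ := KFP.absPt (t₀, x₀, v₀)
  have hC0 := KFP.estimateConst_pos (d := d) (Lam := Lam) hr (le_max_right K 1) (hR1 ρ)
  have hvR : ‖v₀‖ ≤ |ρ| + 1 := by
    have h1 := KFP.norm_vel_le_absPt (t₀, x₀, v₀)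
    have h2 := le_abs_self ρ
    exact h1.trans (by linarith)
  have hsub : KFP.locDomInt Ω 2 (t₀, x₀, v₀) ⊆ KFP.locDom Ω 2 (t₀, x₀, v₀) :=
    fun z hz => ⟨hz.1, subset_closure hz.2.2⟩
  have hν : |(inner ℝ n₀ v₀ : ℝ)| = -inner ℝ n₀ v₀ := abs_of_neg hneg
  rw [real_inner_comm n₀ v₀, hν]
  set ν := -(inner ℝ n₀ v₀ : ℝ)
  have hν0 : 0 < ν := neg_pos.2 hneg
  set C := KFP.estimateConst d Lam r (max K 1) (|ρ| + 1)
  rcases eq_or_ne (KFP.supNorm f (KFP.locDom Ω 2 (t₀, x₀, v₀))) ⊤ with htop | htop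
  · refine ⟨fun z hz => ?_, fun _ x _ _ _ _ => ?_⟩
    -- With an infinite norm the right side is infinite except at `z = z₀`, where the factor `|z -
    -- z₀|` makes it `0 * ⊤ = 0`; there `f` vanishes by the boundary condition.
    · rcases eq_or_ne z (t₀, x₀, v₀) with rfl | hne
      · have : f (t₀, x₀, v₀) = 0 := hsol.boundary _ ⟨⟨hx₀, n₀, hn, hneg⟩,
          KFP.cyl_mono zero_le_one one_le_two _ hz.1⟩
        simp [this]
      · have ha : 0 < KFP.absPt (z - (t₀, x₀, v₀)) := by
          refine lt_of_not_ge fun h => hne ?_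
          have h1 := (KFP.abs_fst_le_absPt (z - (t₀, x₀, v₀))).trans h
          have h2 := (KFP.norm_pos_le_absPt (z - (t₀, x₀, v₀))).trans h
          have h3 := (KFP.norm_vel_le_absPt (z - (t₀, x₀, v₀))).trans h
          rw [abs_nonpos_iff] at h1
          rw [norm_le_zero_iff] at h2 h3
          exact sub_eq_zero.1 (Prod.ext h1 (Prod.ext h2 h3))
        rw [htop, top_add, ENNReal.mul_top]
        · exact le_top
        · exact (ENNReal.ofReal_pos.2 (by positivity)).ne'
    · rw [htop, ENNReal.top_mul]
      · exact le_top
      · exact (ENNReal.ofReal_pos.2 (Real.exp_pos _)).ne'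
  · have hM₀ := fun z (hz : z ∈ KFP.locDom Ω 2 (t₀, x₀, v₀)) => KFP.abs_le_toReal_supNorm htop hz
    have hfin : KFP.essNorm S (KFP.locDom Ω 2 (t₀, x₀, v₀)) ≠ ⊤ := hS.eLpNorm_ne_top
    refine ⟨fun z hz => ?_, fun hS0 x hx hxC hδ _ => ?_⟩
    · have h := KFP.gradient_estimate hΩo hψ' hr (le_max_right _ _) (hR1 ρ) hvR hx₀ hn
        (ν := ν) (neg_neg _).symm hν0 hlam (hlam.trans hlamLam) hell hsol ENNReal.toReal_nonneg hM₀
        ENNReal.toReal_nonneg (KFP.ae_abs_le_toReal_essNorm hsub hS) hz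
      have ha : 0 ≤ KFP.absPt (z - (t₀, x₀, v₀)) := Real.sqrt_nonneg _
      rw [← ENNReal.ofReal_toReal (ENNReal.add_ne_top.2 ⟨htop, hfin⟩),
        ENNReal.toReal_add htop hfin, ← ENNReal.ofReal_mul (by positivity),
        Real.enorm_eq_ofReal_abs]
      exact ENNReal.ofReal_le_ofReal h
    · have h := KFP.infinite_order_vanishing hΩo hψ' hr (le_max_right _ _) (hR1 ρ) hvR hx₀ hn
        (ν := ν) (neg_neg _).symm hν0 hlam (hlam.trans hlamLam) hell hsol ENNReal.toReal_nonneg hM₀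
        hS0 hx hxC hδ
      rw [← ENNReal.ofReal_toReal htop, ← ENNReal.ofReal_mul ENNReal.toReal_nonneg,
        Real.enorm_eq_ofReal_abs]
      exact ENNReal.ofReal_le_ofReal h
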